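/- Let $F$ be a field and let the variables be partitioned as $\bar x=\bar x_0\sqcup\dots\sqcup\bar x_{d+1}$, $|\bar x|=n$. Consider the polynomials $$C(\bar x)=D_0^{T}\Big(\prod_{i=1}^{d}D_i\Big)D_{d+1}\in F[\bar x],\qquad D_0\in F^{w}[\bar x_0],\quad D_i\in F^{w\times w}[\bar x_i]\ (1\le i\le d),\quad D_{d+1}\in F^{w}[\bar x_{d+1}],$$ (read-once algebraic branching programs of width $w$ in matrix form) such that $D_1,\dots,D_d$ are invertible over the field of rational functions, i.e. $\det D_i\neq 0$, and each $D_i$, $0\le i\le d+1$, viewed as a polynomial with vector or matrix coefficients, has degree at most $\delta$ in every variable (in particular, this holds if its total degree is at most $\delta$), has at most $s$ monomials with nonzero coefficient, and each of these monomials involves at most $\mu$ variables. Here $\delta\ge 1$. Let $\mathcal C_F(n,w,\delta,s,\mu)$ be the class of all these polynomials $C$, for all $d$ and all partitions of the $n$ variables, and put $\ell:=1+2\min\{\lceil\log_2(w^2s)\rceil,\mu\}$. There is one algorithm, not depending on the field, which on input $(n,w,\delta,s,\mu)$ outputs a hitting-set for $\mathcal C_F(n,w,\delta,s,\mu)$,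 that is, a finite list of points such that every nonzero $C$ in the class is nonzero at one of the points; both its running time and the number of points are at most $p\big((n\delta s)^{\ell w^2}\big)$ for an absolute polynomial $p$. The points have coordinates in $F$, or in any chosen extension field $K\supseteq F$, provided that $K$ has at least $p\big((n\delta s)^{\ell w^2}\big)$ elements. Consequently, for fixed $w$ and $\mu$ (for instance if $w$ is constant and all the $D_i$ are univariate, so that $\mu=1$), the running time of the algorithm and the number of points are at most $q(n\delta s)$, for a polynomial $q$ depending only on $w$ and $\mu$, provided that $K$ has at least $q(n\delta s)$ elements. (Time is the number of steps of a random access machine with unit-cost addition, truncated subtraction and comparison of natural numbers, indirect addressing, and unit-cost operations $0$, $1$, $+$, $\cdot$ and "$j$-th element of a fixed enumeration" on elements of $K$; the control flow does not depend on field elements, and the enumeration is required to be injective on indices below the time bound.) -/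

import Mathlib

namespace InvROABP

/-! ### Polynomials with vector or matrix coefficients -/

/-- The monomials whose (vector or matrix) coefficient is nonzero, for a polynomial with
coefficients in `F ^ ι` given by its coordinates `f i`. -/
def jointSupport {n : ℕ} {ι F : Type*} [Fintype ι] [CommSemiring F]
    (f : ι → MvPolynomial (Fin n) F) : Finset (Fin n →₀ ℕ) :=
  Finset.univ.biUnion fun i => (f i).support

/-- The polynomial with coefficients in `F ^ ι` has degree at most `δ` in every variable (this is
implied by total degree at most `δ`), at most `s` monomials with nonzero coefficient, and each of
these monomials involves at most `μ` variables. -/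
structure Bounded {n : ℕ} {ι F : Type*} [Fintype ι] [CommSemiring F]
    (f : ι → MvPolynomial (Fin n) F) (δ s μ : ℕ) : Prop where
  degree_le : ∀ e ∈ jointSupport f, ∀ v, e v ≤ δ
  sparsity_le : (jointSupport f).card ≤ s
  support_le : ∀ e ∈ jointSupport f, e.support.card ≤ μ

/-! ### Read-once algebraic branching programs in matrix form -/

/-- A read-once ABP of width `w` in the variables `x_v`, `v : Fin n`, in matrix form
`D₀ᵀ (D₁ ⋯ D_d) D_{d+1}`. The variables are partitioned into `d + 2` blocks (some of them possibly
empty; `block v` is the index of the block of `x_v`), and the entries of the `i`-th factor involve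
only variables of the `i`-th block. -/
structure ROABP (F : Type*) [Field F] (n w : ℕ) where
  /-- the number of matrix factors -/
  d : ℕ
  /-- the row vector `D₀` -/
  left : Fin w → MvPolynomial (Fin n) F
  /-- the matrices `D₁, …, D_d` -/
  factor : Fin d → Matrix (Fin w) (Fin w) (MvPolynomial (Fin n) F)
  /-- the column vector `D_{d+1}` -/
  right : Fin w → MvPolynomial (Fin n) F
  /-- the partition of the variables -/
  block : Fin n → Fin (d + 2)
  left_vars : ∀ k, ∀ v ∈ (left k).vars, block v = 0
  factor_vars : ∀ i k l, ∀ v ∈ (factor i k l).vars, block v = i.succ.castSucc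
  right_vars : ∀ k, ∀ v ∈ (right k).vars, block v = Fin.last (d + 1)

namespace ROABP

variable {F : Type*} [Field F] {n w : ℕ}

/-- The polynomial `D₀ᵀ (D₁ ⋯ D_d) D_{d+1}` computed by the ROABP. -/
noncomputable def poly (A : ROABP F n w) : MvPolynomial (Fin n) F :=
  dotProduct A.left (Matrix.mulVec (List.ofFn A.factor).prod A.right)

/-- Every matrix factor `D₁, …, D_d` is invertible over the field of rational functions. -/
def FactorsInvertible (A : ROABP F n w) : Prop :=
  ∀ i, (A.factor i).det ≠ 0

/-- All of `D₀, …, D_{d+1}` obey the bounds `δ`, `s`, `μ` on degree, sparsity and monomial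
support. -/
def FactorsBounded (A : ROABP F n w) (δ s μ : ℕ) : Prop :=
  Bounded A.left δ s μ ∧
  (∀ i, Bounded (fun kl : Fin w × Fin w => A.factor i kl.1 kl.2) δ s μ) ∧
  Bounded A.right δ s μ

end ROABP

/-- The polynomials computed by sparse-invertible-factor ROABPs of width `w` with parameters
`δ`, `s`, `μ`. The number of factors and the partition of the variables are arbitrary. -/
def polyClass (F : Type*) [Field F] (n w δ s μ : ℕ) : Set (MvPolynomial (Fin n) F) :=
  {C | ∃ A : ROABP F n w, A.FactorsInvertible ∧ A.FactorsBounded δ s μ ∧ A.poly = C}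

/-- `H ⊆ K ^ n` is a hitting-set for a class of polynomials over `F`, where `K` is an extension
of `F`: every nonzero polynomial of the class is nonzero at some point of `H`. -/
def IsHittingSet {F K : Type*} [Field F] [Field K] [Algebra F K] {n : ℕ}
    (H : Set (Fin n → K)) (𝒞 : Set (MvPolynomial (Fin n) F)) : Prop :=
  ∀ C ∈ 𝒞, C ≠ 0 → ∃ a ∈ H, MvPolynomial.aeval a C ≠ 0

/-! ### Algebraic random access machines with a step count

A program works on natural numbers (for control and addressing) and on elements of a field `K`.
There are registers and an indirectly addressed heap of either sort, and a write-only output tape.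
The only arithmetic on natural numbers is addition and truncated subtraction. Field elements are
added and multiplied, and cannot influence the control flow. Distinct field elements are
available through an enumeration `α : ℕ → K`. Programs do not depend on the field. -/

/-- Atomic instructions; arguments are register numbers. -/
inductive Instr
  /-- `x := c` -/
  | const (x c : ℕ)
  /-- `x := y + z` -/
  | add (x y z : ℕ)
  /-- `x := y - z`, truncated at zero -/
  | sub (x y z : ℕ)
  /-- `x := heap[y]` -/
  | load (x y : ℕ)
  /-- `heap[x] := y` -/
  | store (x y : ℕ)
  /-- field register `x := 0` -/
  | fzero (x : ℕ)
  /-- field register `x := 1` -/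
  | fone (x : ℕ)
  /-- field registers: `x := y + z` -/
  | fadd (x y z : ℕ)
  /-- field registers: `x := y * z` -/
  | fmul (x y z : ℕ)
  /-- field register `x := α y`, for the number `y` -/
  | felem (x y : ℕ)
  /-- field register `x := fieldHeap[y]`, for the number `y` -/
  | fload (x y : ℕ)
  /-- `fieldHeap[x] := y`, for the number `x` and the field register `y` -/
  | fstore (x y : ℕ)
  /-- write the field register `x` to the output -/
  | out (x : ℕ)

/-- Structured programs. -/
inductive Prog
  | skip
  | instr (I : Instr)
  | seq (P Q : Prog)
  /-- `if x < y then P else Q` -/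
  | ifLT (x y : ℕ) (P Q : Prog)
  /-- `while x < y do P` -/
  | whileLT (x y : ℕ) (P : Prog)

/-- Machine states; `output` lists what has been written, in order. -/
structure State (K : Type*) where
  reg : ℕ → ℕ
  heap : ℕ → ℕ
  freg : ℕ → K
  fheap : ℕ → K
  output : List K

/-- The effect of an atomic instruction. -/
def Instr.step {K : Type*} [Field K] (α : ℕ → K) (σ : State K) : Instr → State K
  | .const x c => { σ with reg := Function.update σ.reg x c }
  | .add x y z => { σ with reg := Function.update σ.reg x (σ.reg y + σ.reg z) }
  | .sub x y z => { σ with reg := Function.update σ.reg x (σ.reg y - σ.reg z) }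
  | .load x y => { σ with reg := Function.update σ.reg x (σ.heap (σ.reg y)) }
  | .store x y => { σ with heap := Function.update σ.heap (σ.reg x) (σ.reg y) }
  | .fzero x => { σ with freg := Function.update σ.freg x 0 }
  | .fone x => { σ with freg := Function.update σ.freg x 1 }
  | .fadd x y z => { σ with freg := Function.update σ.freg x (σ.freg y + σ.freg z) }
  | .fmul x y z => { σ with freg := Function.update σ.freg x (σ.freg y * σ.freg z) }
  | .felem x y => { σ with freg := Function.update σ.freg x (α (σ.reg y)) }
  | .fload x y => { σ with freg := Function.update σ.freg x (σ.fheap (σ.reg y)) }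
  | .fstore x y => { σ with fheap := Function.update σ.fheap (σ.reg x) (σ.freg y) }
  | .out x => { σ with output := σ.output ++ [σ.freg x] }

/-- `Exec α P σ t τ`: the program `P`, started in the state `σ`, halts in the state `τ` after
exactly `t` steps. Every atomic instruction and every test of a condition is one step. -/
inductive Exec {K : Type*} [Field K] (α : ℕ → K) : Prog → State K → ℕ → State K → Prop
  | skip (σ : State K) : Exec α .skip σ 0 σ
  | instr (I : Instr) (σ : State K) : Exec α (.instr I) σ 1 (I.step α σ)
  | seq {P Q : Prog} {σ ρ τ : State K} {t u : ℕ} :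
      Exec α P σ t ρ → Exec α Q ρ u τ → Exec α (.seq P Q) σ (t + u) τ
  | ifTrue {x y : ℕ} {P Q : Prog} {σ τ : State K} {t : ℕ} :
      σ.reg x < σ.reg y → Exec α P σ t τ → Exec α (.ifLT x y P Q) σ (t + 1) τ
  | ifFalse {x y : ℕ} {P Q : Prog} {σ τ : State K} {t : ℕ} :
      ¬ σ.reg x < σ.reg y → Exec α Q σ t τ → Exec α (.ifLT x y P Q) σ (t + 1) τ
  | whileTrue {x y : ℕ} {P : Prog} {σ ρ τ : State K} {t u : ℕ} :
      σ.reg x < σ.reg y → Exec α P σ t ρ → Exec α (.whileLT x y P) ρ u τ →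
      Exec α (.whileLT x y P) σ (t + u + 1) τ
  | whileFalse {x y : ℕ} {P : Prog} {σ : State K} :
      ¬ σ.reg x < σ.reg y → Exec α (.whileLT x y P) σ 1 σ

/-- The initial state: the registers `0, …, 4` hold the input `n, w, δ, s, μ`; everything else
is zero and the output is empty. -/
def initState (K : Type*) [Field K] (n w δ s μ : ℕ) : State K where
  reg i := [n, w, δ, s, μ].getD i 0
  heap _ := 0
  freg _ := 0
  fheap _ := 0
  output := []

/-- On input `n, w, δ, s, μ`, over every field `F` and every extension `K` of `F` of which the
first `T` elements of an enumeration are distinct, the program `P` halts within `T` steps, having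
written (coordinate by coordinate) a list of at most `T` points of `K ^ n` which is a hitting-set
for `polyClass F n w δ s μ`. The points depend neither on the polynomial nor on the partition of
the variables. -/
def HitsWithin.{u₁, u₂} (P : Prog) (n w δ s μ T : ℕ) : Prop :=
  ∀ (F : Type u₁) (K : Type u₂) [Field F] [Field K] [Algebra F K] (α : ℕ → K),
    Set.InjOn α (Set.Iio T) →
    ∃ (t : ℕ) (τ : State K) (L : List (Fin n → K)),
      Exec α P (initState K n w δ s μ) t τ ∧ t ≤ T ∧
      τ.output = L.flatMap List.ofFn ∧ L.length ≤ T ∧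
      IsHittingSet {a | a ∈ L} (polyClass F n w δ s μ)

/-- `ℓ = 1 + 2 min {⌈log₂ (w² s)⌉, μ}`. -/
def ell (w s μ : ℕ) : ℕ := 1 + 2 * min (Nat.clog 2 (w ^ 2 * s)) μ

end InvROABP

universe u v

namespace InvROABP

/-! ### Products of matrices with few factors exchanged -/

/-! Fix a point `a` at which all matrix factors are invertible and all of whose coordinates are
nonzero. The core of the proof is that a nonzero `C` does not vanish at some point differing from
`a` in at most `r = (w² + 2) m` coordinates, where `m = min (⌈log₂ (w² s)⌉, μ)`, and that the
changed coordinates may be taken from any `δ + 1` fixed field elements.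

To see this, start with any nonzero `y` of `C`. Multiplying each `D_i(y)` by prefix products of the
invertible `D_j(a)` and their inverses turns every mixed product, with `D_i(y)` for `i ∈ J` and
`D_i(a)` elsewhere, into a product over `J` alone times a fixed unit. Among more than `w²` prefixes
of such a product one lies in the span of shorter ones, so a functional that is nonzero on the
product is nonzero on a shorter subproduct. Hence all but `w²` matrix factors can be moved to `a`
(`exists_few_exchanged`). The two end vectors account for the remaining two blocks.

In each block left over, `C` is a linear combination of the entries of one factor, hence a
polynomial with at most `s` monomials in at most `μ` variables each. One of its monomials is
determined by at most `m` exponents (`exists_isolated`). Setting the other variables to `a` cannot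
cancel that monomial, and the remaining variables range over a grid of side `δ + 1`
(`exists_eval_ne_zero_of_isolated`).

For `a` one takes `t ^ (k ^ v mod p)` in coordinate `v`. Only factors containing a variable matter,
so there are at most `n` determinants to keep nonzero, each with at most `s ^ w` monomials. For a
prime `p` that is large but polynomially bounded in these quantities, some `k` gives weights
separating the monomials of every determinant. The product of the resulting univariate polynomials
has bounded degree, so some `t` among the enumerated elements avoids its zeros
(`ROABP.exists_shift`).

The program therefore runs through all `t`, moduli and `k` below a bound `B = M ^ (11 w²)` with `M =
n + δ + s`, and through all lists of `r` pairs (coordinate, value) below `M`. This makes `N = B³ M ^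
(2 r)` points, and the naive arithmetic used costs `O(N⁴)` steps in total. For `n ≥ 2` one has `M ≤
(n δ s)³`, which gives the stated bound. For `n ≤ 1`, or if `w` or `s` is zero, `n δ s` may fail to
control `M`, and these inputs are treated separately. -/

/-- Among more than `dim V` vectors, some vector lies in the span of its predecessors. -/
theorem exists_mem_span_predecessors {k V : Type*} [Field k] [AddCommGroup V] [Module k V]
    [FiniteDimensional k V] (v : ℕ → V) {N : ℕ} (hN : Module.finrank k V < N) :
    ∃ j < N, v j ∈ Submodule.span k (v '' Set.Iio j) := by
  by_contra! h
  have key : ∀ m ≤ N, LinearIndependent k (fun i : Fin m => v i) := by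
    intro m
    induction m with
    | zero => intro _; exact linearIndependent_empty_type
    | succ m ih =>
      intro hm
      rw [linearIndependent_finSucc']
      refine ⟨ih (by omega), fun hmem => h m (by omega) ?_⟩
      refine Submodule.span_mono ?_ hmem
      rintro _ ⟨i, rfl⟩
      exact ⟨i, i.2, rfl⟩
  have := (key N le_rfl).fintype_card_le_finrank
  simp at this
  omega

/-- A linear functional which does not vanish at a product of a list of elements of a
finite-dimensional algebra does not vanish at the product of a sublist of length less than or
equal to the dimension. -/
theorem exists_short_sublist {k R ι : Type*} [Field k] [Ring R] [Algebra k R]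
    [FiniteDimensional k R] (Y : ι → R) (φ : R →ₗ[k] k) (l : List ι) (h : φ (l.map Y).prod ≠ 0) :
    ∃ l' : List ι, l'.Sublist l ∧ l'.length ≤ Module.finrank k R ∧ φ (l'.map Y).prod ≠ 0 := by
  induction hn : l.length using Nat.strong_induction_on generalizing l with
  | _ n ih =>
    subst hn
    by_cases hl : l.length ≤ Module.finrank k R
    · exact ⟨l, List.Sublist.refl l, hl, h⟩
    -- The prefixes of lengths `0, …, l.length - 1` outnumber the dimension. Trading the prefix of
    -- length `j` for a shorter one with the same tail gives a shorter sublist. Were `φ` zero on all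
    -- of these, it would be zero on the span of the shorter prefixes times the tail, hence on the
    -- whole product.
    obtain ⟨j, hj, hmem⟩ := exists_mem_span_predecessors (k := k)
      (fun j => ((l.take j).map Y).prod) (N := l.length) (by omega)
    by_contra! hno
    apply h
    have hl' : (l.map Y).prod = ((l.take j).map Y).prod * ((l.drop j).map Y).prod := by
      rw [← List.prod_append, ← List.map_append, List.take_append_drop]
    rw [hl']
    have hker : Submodule.span k ((fun j => ((l.take j).map Y).prod) '' Set.Iio j) ≤
        LinearMap.ker (φ ∘ₗ LinearMap.mulRight k ((l.drop j).map Y).prod) := by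
      rw [Submodule.span_le]
      rintro _ ⟨i, hi, rfl⟩
      simp only [Set.mem_Iio] at hi
      simp only [SetLike.mem_coe, LinearMap.mem_ker, LinearMap.comp_apply,
        LinearMap.mulRight_apply]
      rw [← List.prod_append, ← List.map_append]
      by_contra hne
      have hsub : (l.take i ++ l.drop j).Sublist l := by
        conv_rhs => rw [← List.take_append_drop j l]
        exact List.Sublist.append (List.take_sublist_take_left hi.le) (List.Sublist.refl _)
      obtain ⟨l', h1, h2, h3⟩ := ih _ (by simp; omega) (l.take i ++ l.drop j) hne rfl
      exact h3 (hno l' (h1.trans hsub) h2)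
    exact hker hmem

theorem filter_mem_of_sublist {ι : Type*} [DecidableEq ι] {l' l : List ι} (h : l'.Sublist l)
    (hl : l.Nodup) : l.filter (· ∈ l') = l' := by
  induction h with
  | slnil => rfl
  | @cons l₁ l₂ a hs ih =>
    rw [List.nodup_cons] at hl
    have : a ∉ l₁ := fun ha => hl.1 (hs.subset ha)
    simp [this, ih hl.2]
  | @cons_cons l₁ l₂ a hs ih =>
    rw [List.nodup_cons] at hl
    rw [List.filter_cons_of_pos (by simp)]
    congr 1
    conv_rhs => rw [← ih hl.2]
    apply List.filter_congr
    intro x hx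
    have : x ≠ a := fun hxa => hl.1 (hxa ▸ hx)
    simp [this]

theorem prod_map_ite_mem {ι R : Type*} [DecidableEq ι] [Monoid R] (Y : ι → R) (p : ι → Prop)
    [DecidablePred p] (l : List ι) :
    (l.map fun i => if p i then Y i else 1).prod = ((l.filter p).map Y).prod := by
  induction l with
  | nil => rfl
  | cons a l ih => by_cases h : p a <;> simp [h, ih]

/-- Neighbouring units `G (i + 1)` and their inverses cancel. This is what reduces a product with
most factors equal to `A i` to a product over the exchanged positions only. -/
theorem prod_range_telescope {R : Type*} [Monoid R] (G : ℕ → Rˣ) (Z : ℕ → R) (d : ℕ) :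
    ((List.range d).map fun i => ((G i)⁻¹ : Rˣ) * Z i * (G (i + 1) : R)).prod =
      ((G 0)⁻¹ : Rˣ) * ((List.range d).map Z).prod * (G d : R) := by
  induction d with
  | zero => simp
  | succ d ih =>
    rw [List.prod_range_succ, ih, List.prod_range_succ]
    simp [mul_assoc]

/-- If all `A i` are units, a linear functional which does not vanish at the product of the `X i`
does not vanish at some product in which all but at most `dim R` of the `X i` are replaced by the
`A i`. -/
theorem exists_few_exchanged_range {k R : Type*} [Field k] [Ring R] [Algebra k R]
    [FiniteDimensional k R] (X : ℕ → R) (A : ℕ → Rˣ) (φ : R →ₗ[k] k) (d : ℕ)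
    (h : φ ((List.range d).map X).prod ≠ 0) :
    ∃ J : Finset ℕ, J.card ≤ Module.finrank k R ∧
      φ ((List.range d).map fun i => if i ∈ J then X i else A i).prod ≠ 0 := by
  -- With `G` the prefix products of `A`, the expression `(G i)⁻¹ * Z * G (i + 1)` equals `A i` for
  -- `Z = 1` and `X i` for `Z = Y i`. Unexchanged positions thus disappear from the product of the
  -- `Y i`.
  let G : ℕ → Rˣ := fun j => ((List.range j).map A).prod
  have hG : ∀ i, G (i + 1) = G i * A i := fun i => List.prod_range_succ _ _
  let Y : ℕ → R := fun i => (G i : R) * X i * ((G (i + 1))⁻¹ : Rˣ)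
  have hJ : ∀ p : ℕ → Prop, ∀ _ : DecidablePred p,
      ((List.range d).map fun i => if p i then X i else A i).prod =
        (((List.range d).filter p).map Y).prod * (G d : R) := by
    intro p _
    have := prod_range_telescope G (fun i => if p i then Y i else 1) d
    rw [prod_map_ite_mem] at this
    have h0 : G 0 = 1 := rfl
    rw [h0, inv_one, Units.val_one, one_mul] at this
    rw [← this]
    congr 1
    apply List.map_congr_left
    intro i _
    split_ifs
    · simp [Y, mul_assoc]
    · simp [hG]
  let ψ : R →ₗ[k] k := φ ∘ₗ LinearMap.mulRight k (G d : R)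
  have hψ : ψ ((List.range d).map Y).prod ≠ 0 := by
    have := hJ (fun _ => True) inferInstance
    simp only [if_true, decide_true, List.filter_true] at this
    simpa [ψ, ← this] using h
  obtain ⟨l', h1, h2, h3⟩ := exists_short_sublist Y ψ _ hψ
  -- `List.range d` has no duplicates, so the short sublist is recovered by filtering for its
  -- members and may be replaced by an index set.
  refine ⟨l'.toFinset, (List.toFinset_card_le l').trans h2, ?_⟩
  rw [hJ (fun i => i ∈ l'.toFinset)]
  simp only [List.mem_toFinset]
  rw [filter_mem_of_sublist h1 List.nodup_range]
  exact h3

theorem ofFn_eq_map_range {R : Type*} {d : ℕ} (f : Fin d → R) (g : ℕ → R)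
    (h : ∀ i : Fin d, g i = f i) : List.ofFn f = (List.range d).map g := by
  apply List.ext_getElem
  · simp
  · intro i h1 h2
    simp at h1
    simp [← h]

/-- Version of `exists_few_exchanged_range` for a finite sequence. -/
theorem exists_few_exchanged {k R : Type*} [Field k] [Ring R] [Algebra k R]
    [FiniteDimensional k R] {d : ℕ} (X A : Fin d → R) (hA : ∀ i, IsUnit (A i)) (φ : R →ₗ[k] k)
    (h : φ (List.ofFn X).prod ≠ 0) :
    ∃ J : Finset (Fin d), J.card ≤ Module.finrank k R ∧
      φ (List.ofFn fun i => if i ∈ J then X i else A i).prod ≠ 0 := by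
  choose U hU using hA
  rw [ofFn_eq_map_range X (fun i => if h : i < d then X ⟨i, h⟩ else 1) (by simp)] at h
  obtain ⟨J, hJ, hne⟩ := exists_few_exchanged_range _
    (fun i => if h : i < d then U ⟨i, h⟩ else 1) φ d h
  refine ⟨Finset.univ.filter fun i : Fin d => (i : ℕ) ∈ J, ?_, ?_⟩
  · refine le_trans ?_ hJ
    rw [← Finset.card_map Fin.valEmbedding]
    apply Finset.card_le_card
    intro x
    simp
    rintro i hi rfl
    exact hi
  · rw [ofFn_eq_map_range _ _ ?_]
    · exact hne
    · intro i
      simp [hU]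

/-- A product of a sequence depends linearly on each of its factors. -/
theorem exists_prod_ofFn_eq_mul {R : Type*} [Monoid R] {d : ℕ} (f : Fin d → R) (i : Fin d) :
    ∃ U V : R, ∀ g : Fin d → R, (∀ j, j ≠ i → g j = f j) → (List.ofFn g).prod = U * g i * V := by
  induction d with
  | zero => exact i.elim0
  | succ d ih =>
    rcases Fin.eq_zero_or_eq_succ i with rfl | ⟨i, rfl⟩
    · refine ⟨1, (List.ofFn fun j : Fin d => f j.succ).prod, fun g hg => ?_⟩
      rw [List.ofFn_succ, List.prod_cons, one_mul]
      congr 3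
      funext j
      exact hg _ (Fin.succ_ne_zero j)
    · obtain ⟨U, V, hUV⟩ := ih (fun j => f j.succ) i
      refine ⟨f 0 * U, V, fun g hg => ?_⟩
      rw [List.ofFn_succ, List.prod_cons, hUV (fun j => g j.succ)
        (fun j hj => hg _ (fun h => hj (Fin.succ_injective _ h))), hg 0 (Fin.succ_ne_zero i).symm]
      simp [mul_assoc]

/-! ### Isolating a monomial by few of its exponents -/

/-- Halving: two distinct monomials differ in some exponent `v`, and the smaller of the two classes
with these values at `v` contains at most half of `S`. Each coordinate added to `R` thus pays for a
factor of two in the cardinality. -/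
theorem exists_isolated_log {n : ℕ} (S : Finset (Fin n →₀ ℕ)) (hS : S.Nonempty) :
    ∃ e ∈ S, ∃ R : Finset (Fin n), 2 ^ R.card ≤ S.card ∧
      ∀ e' ∈ S, (∀ v ∈ R, e' v = e v) → e' = e := by
  induction hN : S.card using Nat.strong_induction_on generalizing S with
  | _ N ih =>
    subst hN
    by_cases h1 : S.card ≤ 1
    · obtain ⟨e, he⟩ := hS
      exact ⟨e, he, ∅, by simpa using ⟨e, he⟩, fun e' he' _ => Finset.card_le_one.1 h1 _ he' _ he⟩
    obtain ⟨e₁, he₁, e₂, he₂, hne⟩ := Finset.one_lt_card.1 (not_le.1 h1)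
    obtain ⟨v, hv⟩ : ∃ v, e₁ v ≠ e₂ v := by
      by_contra! h
      exact hne (Finsupp.ext h)
    obtain ⟨c, hc, hcard⟩ : ∃ c : ℕ, (S.filter fun e : Fin n →₀ ℕ => e v = c).Nonempty ∧
        2 * (S.filter fun e : Fin n →₀ ℕ => e v = c).card ≤ S.card := by
      have hdisj : Disjoint (S.filter fun e : Fin n →₀ ℕ => e v = e₁ v) (S.filter fun e : Fin n →₀ ℕ => e v = e₂ v) := by
        rw [Finset.disjoint_filter]
        intro e _ h h'
        exact hv (h.symm.trans h')
      have hle : (S.filter fun e : Fin n →₀ ℕ => e v = e₁ v).card + (S.filter fun e : Fin n →₀ ℕ => e v = e₂ v).card ≤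
          S.card := by
        rw [← Finset.card_union_of_disjoint hdisj]
        exact Finset.card_le_card (Finset.union_subset (Finset.filter_subset _ _)
          (Finset.filter_subset _ _))
      rcases le_total (S.filter fun e : Fin n →₀ ℕ => e v = e₁ v).card (S.filter fun e : Fin n →₀ ℕ => e v = e₂ v).card with
        h | h
      · exact ⟨e₁ v, ⟨e₁, by simp [he₁]⟩, by omega⟩
      · exact ⟨e₂ v, ⟨e₂, by simp [he₂]⟩, by omega⟩
    obtain ⟨e, he, R, hR, hiso⟩ := ih _ (by have := hc.card_pos; omega) _ hc rfl
    rw [Finset.mem_filter] at he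
    refine ⟨e, he.1, insert v R, ?_, fun e' he' h => hiso e' ?_ fun u hu => h u (by simp [hu])⟩
    · calc 2 ^ (insert v R).card ≤ 2 ^ (R.card + 1) :=
            Nat.pow_le_pow_right (by norm_num) (Finset.card_insert_le _ _)
        _ ≤ S.card := by rw [pow_succ]; omega
    · rw [Finset.mem_filter]
      exact ⟨he', (h v (by simp)).trans he.2⟩

/-- A monomial with the largest number of variables works: agreement on its support forces
containment of supports, and maximality turns this into equality. -/
theorem exists_isolated_support {n : ℕ} (S : Finset (Fin n →₀ ℕ)) (hS : S.Nonempty) :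
    ∃ e ∈ S, ∀ e' ∈ S, (∀ v ∈ e.support, e' v = e v) → e' = e := by
  obtain ⟨e, he, hmax⟩ := Finset.exists_max_image S (fun e => e.support.card) hS
  refine ⟨e, he, fun e' he' h => ?_⟩
  have hsub : e.support ⊆ e'.support := by
    intro v hv
    rw [Finsupp.mem_support_iff, h v hv]
    exact Finsupp.mem_support_iff.1 hv
  have heq : e.support = e'.support := Finset.eq_of_subset_of_card_le hsub (hmax e' he')
  ext v
  by_cases hv : v ∈ e.support
  · exact h v hv
  · rw [Finsupp.notMem_support_iff.1 hv]
    rw [heq] at hv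
    exact Finsupp.notMem_support_iff.1 hv

/-- Among at most `2 ^ c` monomials in at most `μ` variables each, some monomial is determined by
`min c μ` of its exponents. -/
theorem exists_isolated {n c μ : ℕ} (S : Finset (Fin n →₀ ℕ)) (hS : S.Nonempty)
    (hc : S.card ≤ 2 ^ c) (hμ : ∀ e ∈ S, e.support.card ≤ μ) :
    ∃ e ∈ S, ∃ R : Finset (Fin n), R.card ≤ min c μ ∧
      ∀ e' ∈ S, (∀ v ∈ R, e' v = e v) → e' = e := by
  rcases le_total c μ with h | h
  · obtain ⟨e, he, R, hR, hiso⟩ := exists_isolated_log S hS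
    refine ⟨e, he, R, ?_, hiso⟩
    rw [min_eq_left h]
    exact (Nat.pow_le_pow_iff_right (by norm_num)).1 (hR.trans hc)
  · obtain ⟨e, he, hiso⟩ := exists_isolated_support S hS
    exact ⟨e, he, e.support, by rw [min_eq_right h]; exact hμ e he, hiso⟩

/-- If a monomial of `g` is determined, among the monomials of `g`, by its exponents in `R`, then
`g` does not vanish at some point which agrees with `a` outside `R` and has coordinates in a given
large set on `R`, whenever all coordinates of `a` are nonzero. -/
theorem exists_eval_ne_zero_of_isolated {n : ℕ} {E : Type*} [Field E]
    (g : MvPolynomial (Fin n) E) {e : Fin n →₀ ℕ} (he : e ∈ g.support) (R : Finset (Fin n))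
    (hiso : ∀ e' ∈ g.support, (∀ v ∈ R, e' v = e v) → e' = e) (a : Fin n → E)
    (ha : ∀ v, a v ≠ 0) {δ : ℕ} (hδ : ∀ e' ∈ g.support, ∀ v, e' v ≤ δ) (B : Finset E)
    (hB : δ < B.card) :
    ∃ z : Fin n → E, (∀ v, v ∉ R → z v = a v) ∧ (∀ v ∈ R, z v ∈ B) ∧
      MvPolynomial.eval z g ≠ 0 := by
  classical
  -- This is `g` with the variables outside `R` set to `a`. The monomial `e` restricted to `R`
  -- receives a contribution from `e` alone, by isolation, and the power product of `a` in that
  -- contribution is nonzero, so `h` is nonzero. Its degree in each variable is at most `δ`, so it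
  -- cannot vanish on the whole grid.
  let h : MvPolynomial (Fin n) E := ∑ e' ∈ g.support,
    MvPolynomial.monomial (e'.filter (· ∈ R)) (g.coeff e' * ∏ v ∈ Finset.univ \ R, a v ^ e' v)
  have heval : ∀ z, MvPolynomial.eval z h =
      MvPolynomial.eval (fun v => if v ∈ R then z v else a v) g := by
    intro z
    rw [MvPolynomial.eval_eq' _ g, map_sum]
    apply Finset.sum_congr rfl
    intro e' _
    rw [MvPolynomial.eval_monomial, mul_assoc]
    congr 1
    rw [← Finset.prod_sdiff (Finset.subset_univ R)]
    congr 1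
    · apply Finset.prod_congr rfl
      intro v hv
      rw [if_neg (Finset.mem_sdiff.1 hv).2]
    · rw [Finsupp.prod_of_support_subset _ (s := R)]
      · apply Finset.prod_congr rfl
        intro v hv
        simp [hv]
      · intro v hv
        simp at hv
        exact hv.2
      · simp
  have hcoeff : h.coeff (e.filter (· ∈ R)) ≠ 0 := by
    simp only [h, MvPolynomial.coeff_sum, MvPolynomial.coeff_monomial]
    rw [Finset.sum_eq_single e]
    · rw [if_pos rfl]
      refine mul_ne_zero (MvPolynomial.mem_support_iff.1 he) (Finset.prod_ne_zero_iff.2 ?_)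
      intro v _
      exact pow_ne_zero _ (ha v)
    · intro e' he' hne
      rw [if_neg]
      intro heq
      apply hne
      apply hiso e' he'
      intro v hv
      have := DFunLike.congr_fun heq v
      simpa [hv] using this
    · intro hn
      exact absurd he hn
  have hne : h ≠ 0 := by
    rintro h0
    rw [h0] at hcoeff
    simp at hcoeff
  have hdeg : ∀ v, h.degreeOf v ≤ δ := by
    intro v
    rw [MvPolynomial.degreeOf_le_iff]
    intro m hm
    obtain ⟨e', he', hm'⟩ := Finset.mem_biUnion.1 (MvPolynomial.support_sum hm)
    have := Finset.mem_singleton.1 (MvPolynomial.support_monomial_subset hm')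
    rw [this]
    by_cases hv : v ∈ R
    · simpa [hv] using hδ e' he' v
    · simp [hv]
  obtain ⟨z, hz, hz'⟩ : ∃ z : Fin n → E, (∀ v, z v ∈ B) ∧ MvPolynomial.eval z h ≠ 0 := by
    by_contra! hno
    exact hne (MvPolynomial.eq_zero_of_eval_zero_at_prod_finset h (fun _ => B)
      (fun v => (hdeg v).trans_lt hB) hno)
  refine ⟨fun v => if v ∈ R then z v else a v, ?_, ?_, ?_⟩
  · intro v hv
    simp [hv]
  · intro v hv
    simpa [hv] using hz v
  · rwa [← heval]

/-! ### Replacing the coordinates of a nonzero of a ROABP block by block -/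

namespace ROABP

variable {F E : Type*} [Field F] [Field E] [Algebra F E] {n w : ℕ}

/-- The value at `z` of the `i`-th matrix factor. -/
noncomputable def factorAt (A : ROABP F n w) (z : Fin n → E) (i : Fin A.d) :
    Matrix (Fin w) (Fin w) E :=
  (A.factor i).map (MvPolynomial.aeval z)

/-- The value at `z` of the first factor. -/
noncomputable def leftAt (A : ROABP F n w) (z : Fin n → E) : Fin w → E :=
  fun k => MvPolynomial.aeval z (A.left k)

/-- The value at `z` of the last factor. -/
noncomputable def rightAt (A : ROABP F n w) (z : Fin n → E) : Fin w → E :=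
  fun k => MvPolynomial.aeval z (A.right k)

theorem aeval_poly (A : ROABP F n w) (z : Fin n → E) :
    MvPolynomial.aeval z A.poly =
      A.leftAt z ⬝ᵥ ((List.ofFn (A.factorAt z)).prod.mulVec (A.rightAt z)) := by
  have hprod : (List.ofFn (A.factorAt z)).prod =
      (List.ofFn A.factor).prod.map (MvPolynomial.aeval z) := by
    have := map_list_prod (MvPolynomial.aeval z : MvPolynomial (Fin n) F →ₐ[F] E).mapMatrix
      (List.ofFn A.factor)
    rw [List.map_ofFn] at this
    exact this.symm
  rw [hprod]
  simp only [poly, dotProduct, Matrix.mulVec, map_sum, map_mul, leftAt, rightAt, Matrix.map_apply]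

theorem aeval_congr_of_vars {p : MvPolynomial (Fin n) F} {z z' : Fin n → E}
    (h : ∀ v ∈ p.vars, z v = z' v) : MvPolynomial.aeval z p = MvPolynomial.aeval z' p :=
  MvPolynomial.eval₂Hom_congr' rfl (fun v hv _ => h v hv) rfl

theorem factorAt_congr (A : ROABP F n w) {z z' : Fin n → E} (i : Fin A.d)
    (h : ∀ v, A.block v = i.succ.castSucc → z v = z' v) : A.factorAt z i = A.factorAt z' i := by
  ext k l
  exact aeval_congr_of_vars fun v hv => h v (A.factor_vars i k l v hv)

theorem leftAt_congr (A : ROABP F n w) {z z' : Fin n → E}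
    (h : ∀ v, A.block v = 0 → z v = z' v) : A.leftAt z = A.leftAt z' := by
  ext k
  exact aeval_congr_of_vars fun v hv => h v (A.left_vars k v hv)

theorem rightAt_congr (A : ROABP F n w) {z z' : Fin n → E}
    (h : ∀ v, A.block v = Fin.last _ → z v = z' v) : A.rightAt z = A.rightAt z' := by
  ext k
  exact aeval_congr_of_vars fun v hv => h v (A.right_vars k v hv)

end ROABP

/-! ### Restriction of a program to the variables of one block -/

/-- A linear combination of the coordinates of a polynomial with vector coefficients. -/
noncomputable def lincomb {F E ι : Type*} [Field F] [Field E] [Algebra F E] [Fintype ι] {n : ℕ}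
    (c : ι → E) (f : ι → MvPolynomial (Fin n) F) : MvPolynomial (Fin n) E :=
  ∑ k, MvPolynomial.C (c k) * (f k).map (algebraMap F E)

section lincomb

variable {F E ι : Type*} [Field F] [Field E] [Algebra F E] [Fintype ι] {n : ℕ}

theorem eval_lincomb (c : ι → E) (f : ι → MvPolynomial (Fin n) F) (z : Fin n → E) :
    MvPolynomial.eval z (lincomb c f) = ∑ k, c k * MvPolynomial.aeval z (f k) := by
  simp [lincomb, MvPolynomial.eval_map, MvPolynomial.aeval_def]

theorem support_lincomb_subset (c : ι → E) (f : ι → MvPolynomial (Fin n) F) :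
    (lincomb c f).support ⊆ jointSupport f := by
  classical
  intro e he
  obtain ⟨k, _, hk⟩ := Finset.mem_biUnion.1 (MvPolynomial.support_sum he)
  rw [MvPolynomial.mem_support_iff, MvPolynomial.coeff_C_mul, MvPolynomial.coeff_map] at hk
  unfold jointSupport
  simp only [Finset.mem_biUnion, Finset.mem_univ, true_and, MvPolynomial.mem_support_iff]
  refine ⟨k, fun h0 => hk ?_⟩
  rw [h0]
  simp

end lincomb

namespace ROABP

variable {F E : Type*} [Field F] [Field E] [Algebra F E] {n w : ℕ}

/-- As a function of the variables in one block, the polynomial computed by a ROABP is a linear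
combination of the entries of the factor that belongs to this block. -/
theorem exists_block_polynomial (A : ROABP F n w) {δ s μ : ℕ} (hA : A.FactorsBounded δ s μ)
    (b : Fin (A.d + 2)) (y : Fin n → E) :
    ∃ g : MvPolynomial (Fin n) E,
      ((∀ e ∈ g.support, ∀ v, e v ≤ δ) ∧ g.support.card ≤ s ∧
        ∀ e ∈ g.support, e.support.card ≤ μ) ∧
      (∀ z : Fin n → E, (∀ v, A.block v ≠ b → z v = y v) →
        MvPolynomial.aeval z A.poly = MvPolynomial.eval z g) ∧
      ∀ z z' : Fin n → E, (∀ v, A.block v = b → z v = z' v) →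
        MvPolynomial.eval z g = MvPolynomial.eval z' g := by
  have hb : ∀ {ι : Type} [Fintype ι] (c : ι → E) (f : ι → MvPolynomial (Fin n) F),
      Bounded f δ s μ → ((∀ e ∈ (lincomb c f).support, ∀ v, e v ≤ δ) ∧
        (lincomb c f).support.card ≤ s ∧ ∀ e ∈ (lincomb c f).support, e.support.card ≤ μ) := by
    intro ι _ c f hf
    have hs := support_lincomb_subset c f
    exact ⟨fun e he => hf.degree_le e (hs he), (Finset.card_le_card hs).trans hf.sparsity_le,
      fun e he => hf.support_le e (hs he)⟩
  obtain ⟨h1, h2, h3⟩ := hA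
  induction b using Fin.lastCases with
  | last =>
    refine ⟨lincomb (Matrix.vecMul (A.leftAt y) (List.ofFn (A.factorAt y)).prod) A.right,
      hb _ _ h3, fun z hz => ?_, fun z z' h => ?_⟩
    · rw [aeval_poly, eval_lincomb, Matrix.dotProduct_mulVec]
      have e1 : A.leftAt z = A.leftAt y := A.leftAt_congr fun v hv => hz v (by
        rw [hv]; exact (Fin.last_pos).ne)
      have e2 : A.factorAt z = A.factorAt y := funext fun i => A.factorAt_congr i
        fun v hv => hz v (by rw [hv]; exact (Fin.castSucc_lt_last _).ne)
      rw [e1, e2]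
      rfl
    · rw [eval_lincomb, eval_lincomb]
      exact Finset.sum_congr rfl fun k _ => congrArg (_ * ·) (congrFun (A.rightAt_congr h) k)
  | cast b =>
    rcases Fin.eq_zero_or_eq_succ b with rfl | ⟨i, rfl⟩
    · refine ⟨lincomb ((List.ofFn (A.factorAt y)).prod.mulVec (A.rightAt y)) A.left,
        hb _ _ h1, fun z hz => ?_, fun z z' h => ?_⟩
      · rw [aeval_poly, eval_lincomb]
        have e1 : A.rightAt z = A.rightAt y := A.rightAt_congr fun v hv => hz v (by
          rw [hv]; exact (Fin.last_pos).ne')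
        have e2 : A.factorAt z = A.factorAt y := funext fun i => A.factorAt_congr i
          fun v hv => hz v (by
            rw [hv]; intro h; exact Fin.succ_ne_zero i (Fin.castSucc_injective _ h))
        rw [e1, e2, dotProduct]
        exact Finset.sum_congr rfl fun k _ => mul_comm _ _
      · rw [eval_lincomb, eval_lincomb]
        exact Finset.sum_congr rfl fun k _ => congrArg (_ * ·) (congrFun (A.leftAt_congr h) k)
    · obtain ⟨U, V, hUV⟩ := exists_prod_ofFn_eq_mul (A.factorAt y) i
      -- The value is bilinear in what stands to the left and to the right of the factor: the entry
      -- `(k, l)` is weighted by the `k`-th coordinate of the left row vector times the `l`-th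
      -- coordinate of the right column vector.
      refine ⟨lincomb (fun kl : Fin w × Fin w => (Matrix.vecMul (A.leftAt y) U) kl.1 *
        (V.mulVec (A.rightAt y)) kl.2) (fun kl : Fin w × Fin w => A.factor i kl.1 kl.2),
        hb _ _ (h2 i), fun z hz => ?_, fun z z' h => ?_⟩
      · rw [aeval_poly, eval_lincomb]
        have e1 : A.rightAt z = A.rightAt y := A.rightAt_congr fun v hv => hz v (by
          rw [hv]; exact (Fin.castSucc_lt_last _).ne')
        have e2 : A.leftAt z = A.leftAt y := A.leftAt_congr fun v hv => hz v (by
          rw [hv]; intro h; exact Fin.succ_ne_zero i (Fin.castSucc_injective _ h.symm))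
        have e3 : (List.ofFn (A.factorAt z)).prod = U * A.factorAt z i * V :=
          hUV _ fun j hj => A.factorAt_congr j fun v hv => hz v (by
            rw [hv]; intro h
            exact hj (Fin.succ_injective _ (Fin.castSucc_injective _ h)))
        rw [e1, e2, e3, ← Matrix.mulVec_mulVec, ← Matrix.mulVec_mulVec, Matrix.dotProduct_mulVec,
          dotProduct, Fintype.sum_prod_type]
        refine Finset.sum_congr rfl fun k _ => ?_
        rw [Matrix.mulVec, dotProduct, Finset.mul_sum]
        refine Finset.sum_congr rfl fun l _ => ?_
        simp only [factorAt, Matrix.map_apply]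
        ring
      · rw [eval_lincomb, eval_lincomb]
        exact Finset.sum_congr rfl fun kl _ => congrArg (_ * ·)
          (congrFun (congrFun (A.factorAt_congr i h) kl.1) kl.2)

/-- A nonzero `y` of the polynomial computed by a ROABP can be changed, in the blocks from a set
`𝓑`, to agree with `a` up to few coordinates. -/
theorem exists_nonzero_near (A : ROABP F n w) {δ s μ c : ℕ} (hA : A.FactorsBounded δ s μ)
    (hs : s ≤ 2 ^ c) (a : Fin n → E) (ha : ∀ v, a v ≠ 0) (G : Finset E) (hG : δ < G.card)
    (𝓑 : Finset (Fin (A.d + 2))) (y : Fin n → E) (hy : MvPolynomial.aeval y A.poly ≠ 0) :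
    ∃ (z : Fin n → E) (R : Finset (Fin n)), R.card ≤ 𝓑.card * min c μ ∧
      MvPolynomial.aeval z A.poly ≠ 0 ∧ (∀ v, A.block v ∉ 𝓑 → z v = y v) ∧
      (∀ v, A.block v ∈ 𝓑 → v ∉ R → z v = a v) ∧ ∀ v ∈ R, A.block v ∈ 𝓑 ∧ z v ∈ G := by
  classical
  induction 𝓑 using Finset.induction_on with
  | empty => exact ⟨y, ∅, by simp, hy, by simp, by simp, by simp⟩
  | insert b 𝓑 hb ih =>
    obtain ⟨z, R, hR, hz, hz1, hz2, hz3⟩ := ih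
    obtain ⟨g, ⟨hg1, hg2, hg3⟩, hg4, hg5⟩ := A.exists_block_polynomial hA b z
    have hgz : MvPolynomial.eval z g ≠ 0 := by rwa [← hg4 z fun _ _ => rfl]
    have hgne : g.support.Nonempty := by
      rw [Finset.nonempty_iff_ne_empty, ne_eq, MvPolynomial.support_eq_empty]
      rintro rfl
      simp at hgz
    obtain ⟨e, he, R', hR', hiso⟩ := exists_isolated g.support hgne (hg2.trans hs) hg3
    obtain ⟨x, hx1, hx2, hx3⟩ := exists_eval_ne_zero_of_isolated g he R' hiso a ha hg1 G hG
    -- The set `R'` and the changes in `x` are not known to stay inside block `b`. Since `g` depends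
    -- on that block only, `x` is copied there alone and `R'` is cut down accordingly.
    refine ⟨fun v => if A.block v = b then x v else z v, R ∪ R'.filter fun v => A.block v = b,
      ?_, ?_, ?_, ?_, ?_⟩
    · rw [Finset.card_insert_of_notMem hb, add_mul, one_mul]
      exact (Finset.card_union_le _ _).trans
        (add_le_add hR ((Finset.card_filter_le _ _).trans hR'))
    · rw [hg4 _ (fun v hv => by simp [hv]), hg5 _ x (fun v hv => by simp [hv])]
      exact hx3
    · intro v hv
      simp only [Finset.mem_insert, not_or] at hv
      simp [hv.1, hz1 v hv.2]
    · intro v hv hvR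
      simp only [Finset.mem_union, Finset.mem_filter, not_or, not_and] at hvR
      by_cases hvb : A.block v = b
      · simp only [hvb, if_true]
        exact hx1 v fun h => hvR.2 h hvb
      · simp only [hvb, if_false]
        exact hz2 v ((Finset.mem_insert.1 hv).resolve_left hvb) hvR.1
    · intro v hv
      simp only [Finset.mem_union, Finset.mem_filter] at hv
      by_cases hvb : A.block v = b
      · simp only [hvb, if_true]
        refine ⟨Finset.mem_insert_self _ _, ?_⟩
        rcases hv with hv | hv
        · exact absurd (hvb ▸ (hz3 v hv).1) hb
        · exact hx2 v hv.1
      · simp only [hvb, if_false]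
        rcases hv with hv | hv
        · exact ⟨Finset.mem_insert_of_mem (hz3 v hv).1, (hz3 v hv).2⟩
        · exact absurd hv.2 hvb

/-- If all matrix factors are invertible at `a`, then a nonzero `y` of the polynomial computed by a
ROABP can be changed to agree with `a` outside few blocks. -/
theorem exists_nonzero_few_blocks (A : ROABP F n w) (a y : Fin n → E)
    (ha : ∀ i, (A.factorAt a i).det ≠ 0) (hy : MvPolynomial.aeval y A.poly ≠ 0) :
    ∃ (𝓑 : Finset (Fin (A.d + 2))) (z : Fin n → E), 𝓑.card ≤ w ^ 2 + 2 ∧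
      MvPolynomial.aeval z A.poly ≠ 0 ∧ ∀ v, A.block v ∉ 𝓑 → z v = a v := by
  classical
  let φ : Matrix (Fin w) (Fin w) E →ₗ[E] E :=
    { toFun := fun Z => A.leftAt y ⬝ᵥ Z.mulVec (A.rightAt y)
      map_add' := by intro Z Z'; rw [Matrix.add_mulVec, dotProduct_add]
      map_smul' := by intro r Z; rw [Matrix.smul_mulVec, dotProduct_smul]; rfl }
  obtain ⟨J, hJ, hne⟩ := exists_few_exchanged (A.factorAt y) (A.factorAt a)
    (fun i => (Matrix.isUnit_iff_isUnit_det _).2 (ha i).isUnit) φ (by rwa [aeval_poly] at hy)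
  -- The exchange argument does not touch the end vectors, so their blocks keep the values of `y`;
  -- this is the `+ 2` in the bound.
  obtain ⟨𝓑, hcard, h0, hlast, hJ𝓑⟩ : ∃ 𝓑 : Finset (Fin (A.d + 2)), 𝓑.card ≤ J.card + 2 ∧
      0 ∈ 𝓑 ∧ Fin.last _ ∈ 𝓑 ∧ ∀ i : Fin A.d, i.succ.castSucc ∈ 𝓑 ↔ i ∈ J := by
    refine ⟨insert 0 (insert (Fin.last _) (J.image fun i => i.succ.castSucc)), ?_,
      Finset.mem_insert_self _ _, Finset.mem_insert_of_mem (Finset.mem_insert_self _ _),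
      fun i => ?_⟩
    · exact (Finset.card_insert_le _ _).trans (Nat.succ_le_succ
        ((Finset.card_insert_le _ _).trans (Nat.succ_le_succ Finset.card_image_le)))
    · rw [Finset.mem_insert, Finset.mem_insert, Finset.mem_image]
      refine ⟨fun h => ?_, fun h => Or.inr (Or.inr ⟨i, h, rfl⟩)⟩
      rcases h with h | h | ⟨j, hj, h⟩
      · exact absurd (Fin.castSucc_injective _ h) (Fin.succ_ne_zero i)
      · exact absurd h (Fin.castSucc_lt_last _).ne
      · exact Fin.succ_injective _ (Fin.castSucc_injective _ h) ▸ hj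
  refine ⟨𝓑, fun v => if A.block v ∈ 𝓑 then y v else a v, ?_, ?_, fun v hv => if_neg hv⟩
  · rw [Module.finrank_matrix] at hJ
    have : Fintype.card (Fin w) * Fintype.card (Fin w) * Module.finrank E E = w ^ 2 := by
      simp [sq]
    omega
  · rw [aeval_poly, A.leftAt_congr (z' := y) (fun v hv => if_pos (hv ▸ h0)),
      A.rightAt_congr (z' := y) (fun v hv => if_pos (hv ▸ hlast))]
    have hf : A.factorAt (fun v => if A.block v ∈ 𝓑 then y v else a v) =
        fun i => if i ∈ J then A.factorAt y i else A.factorAt a i := by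
      funext i
      by_cases hi : i ∈ J
      · rw [if_pos hi]
        exact A.factorAt_congr i fun v hv => if_pos (hv ▸ (hJ𝓑 i).2 hi)
      · rw [if_neg hi]
        exact A.factorAt_congr i fun v hv => if_neg fun h => hi ((hJ𝓑 i).1 (hv ▸ h))
    rw [hf]
    exact hne

theorem exists_aeval_ne_zero [Infinite E] (p : MvPolynomial (Fin n) F) (hp : p ≠ 0) :
    ∃ y : Fin n → E, MvPolynomial.aeval y p ≠ 0 := by
  by_contra! h
  apply hp
  apply MvPolynomial.map_injective (algebraMap F E) (algebraMap F E).injective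
  rw [map_zero]
  apply MvPolynomial.funext
  intro y
  rw [MvPolynomial.eval_map, map_zero, ← h y, MvPolynomial.aeval_def]

/-- A nonzero polynomial computed by a ROABP does not vanish at some point that differs from `a`
in few coordinates, if all matrix factors are invertible at `a` and no coordinate of `a` is zero. -/
theorem exists_aeval_ne_zero_near (A : ROABP F n w) {δ s μ c : ℕ} (hA : A.FactorsBounded δ s μ)
    (hs : s ≤ 2 ^ c) (a : Fin n → E) (ha : ∀ v, a v ≠ 0)
    (hdet : ∀ i, MvPolynomial.aeval a (A.factor i).det ≠ 0) (G : Finset E) (hG : δ < G.card)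
    (hne : A.poly ≠ 0) :
    ∃ (z : Fin n → E) (R : Finset (Fin n)), R.card ≤ (w ^ 2 + 2) * min c μ ∧
      MvPolynomial.aeval z A.poly ≠ 0 ∧ (∀ v, v ∉ R → z v = a v) ∧ ∀ v ∈ R, z v ∈ G := by
  classical
  -- Over a finite `E` a nonzero polynomial may vanish at all points, so the initial `y` is taken
  -- over the algebraic closure. The final point has all coordinates from `a` or from `G`, and
  -- therefore descends to `E`.
  let E' := AlgebraicClosure E
  let ι := algebraMap E E'
  have hι : Function.Injective ι := ι.injective
  have hcomp : ∀ (z : Fin n → E) (p : MvPolynomial (Fin n) F),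
      MvPolynomial.aeval (fun v => ι (z v)) p = ι (MvPolynomial.aeval z p) := fun z p => by
    rw [← MvPolynomial.aeval_algebraMap_apply]
    rfl
  obtain ⟨y, hy⟩ := exists_aeval_ne_zero (E := E') A.poly hne
  have hdet' : ∀ i, (A.factorAt (fun v => ι (a v)) i).det ≠ 0 := by
    intro i
    have : (A.factorAt (fun v => ι (a v)) i).det =
        MvPolynomial.aeval (fun v => ι (a v)) (A.factor i).det := by
      rw [AlgHom.map_det]
      rfl
    rw [this, hcomp]
    exact fun h => hdet i (hι (by rw [h, map_zero]))
  obtain ⟨𝓑, x, h𝓑, hx, hxa⟩ := A.exists_nonzero_few_blocks (fun v => ι (a v)) y hdet' hy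
  obtain ⟨z, R, hR, hz, hz1, hz2, hz3⟩ := A.exists_nonzero_near hA hs (fun v => ι (a v))
    (fun v h => ha v (hι (by simpa using h))) (G.image ι)
    (by rwa [Finset.card_image_of_injective _ hι]) 𝓑 x hx
  have hza : ∀ v, v ∉ R → z v = ι (a v) := fun v hv => by
    by_cases hb : A.block v ∈ 𝓑
    · exact hz2 v hb hv
    · rw [hz1 v hb, hxa v hb]
  have hzG : ∀ v, ∃ u, ι u = z v ∧ (v ∉ R → u = a v) ∧ (v ∈ R → u ∈ G) := fun v => by
    by_cases hv : v ∈ R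
    · obtain ⟨u, hu, huz⟩ := Finset.mem_image.1 (hz3 v hv).2
      exact ⟨u, huz, fun h => absurd hv h, fun _ => hu⟩
    · exact ⟨a v, (hza v hv).symm, fun _ => rfl, fun h => absurd h hv⟩
  choose z' hz' hz'a hz'G using hzG
  refine ⟨z', R, hR.trans (Nat.mul_le_mul_right _ h𝓑), fun h => hz ?_, hz'a, hz'G⟩
  have : z = fun v => ι (z' v) := funext fun v => (hz' v).symm
  rw [this, hcomp, h, map_zero]

end ROABP

/-! ### A point at which all factors are invertible -/

theorem exists_sum_of_mem_support_prod {σ R ι : Type*} [CommSemiring R] (t : Finset ι)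
    (f : ι → MvPolynomial σ R) {e : σ →₀ ℕ} (he : e ∈ (∏ i ∈ t, f i).support) :
    ∃ g : ι → σ →₀ ℕ, (∀ i ∈ t, g i ∈ (f i).support) ∧ e = ∑ i ∈ t, g i := by
  classical
  induction t using Finset.induction_on generalizing e with
  | empty =>
    rw [Finset.prod_empty] at he
    refine ⟨0, by simp, ?_⟩
    by_contra hne
    rw [Finset.sum_empty] at hne
    rw [MvPolynomial.mem_support_iff, MvPolynomial.coeff_one, if_neg (Ne.symm hne)] at he
    exact he rfl
  | insert a t ha ih =>
    rw [Finset.prod_insert ha] at he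
    obtain ⟨u, hu, v, hv, rfl⟩ := Finset.mem_add.1 (MvPolynomial.support_mul _ _ he)
    obtain ⟨g, hg, rfl⟩ := ih hv
    have hga : ∀ i ∈ t, Function.update g a u i = g i := fun i hi =>
      Function.update_of_ne (ne_of_mem_of_not_mem hi ha) _ _
    refine ⟨Function.update g a u, fun i hi => ?_, ?_⟩
    · rcases Finset.mem_insert.1 hi with rfl | hi
      · simpa using hu
      · rw [hga i hi]
        exact hg i hi
    · rw [Finset.sum_insert ha, Function.update_self, Finset.sum_congr rfl hga]

/-- By the Leibniz formula, each monomial of the determinant is a product of `w` monomials of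
entries. -/
theorem exists_sum_of_mem_support_det {n w : ℕ} {F : Type*} [CommRing F]
    (D : Matrix (Fin w) (Fin w) (MvPolynomial (Fin n) F)) {e : Fin n →₀ ℕ}
    (he : e ∈ D.det.support) :
    ∃ g : Fin w → Fin n →₀ ℕ,
      (∀ i, g i ∈ jointSupport fun kl : Fin w × Fin w => D kl.1 kl.2) ∧ e = ∑ i, g i := by
  rw [MvPolynomial.mem_support_iff, Matrix.det_apply, MvPolynomial.coeff_sum] at he
  obtain ⟨σ, _, hσ⟩ := Finset.exists_ne_zero_of_sum_ne_zero he
  have hσ' : e ∈ (∏ i, D (σ i) i).support := by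
    rw [MvPolynomial.mem_support_iff]
    intro h
    rw [Units.smul_def, MvPolynomial.coeff_smul, h, smul_zero] at hσ
    exact hσ rfl
  obtain ⟨g, hg, he⟩ := exists_sum_of_mem_support_prod _ _ hσ'
  refine ⟨g, fun i => ?_, he⟩
  exact Finset.mem_biUnion.2 ⟨(σ i, i), Finset.mem_univ _, hg i (Finset.mem_univ _)⟩

/-- The sparsity bound concerns the joint support of all entries, so the sums of `w` exponents from
it number at most `s ^ w`, whatever the permutation in the Leibniz formula; no factor `w!` arises.
-/
theorem Bounded.det {n w : ℕ} {F : Type*} [CommRing F]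
    {D : Matrix (Fin w) (Fin w) (MvPolynomial (Fin n) F)} {δ s μ : ℕ}
    (hD : Bounded (fun kl : Fin w × Fin w => D kl.1 kl.2) δ s μ) :
    D.det.support.card ≤ s ^ w ∧ ∀ e ∈ D.det.support, ∀ v, e v ≤ w * δ := by
  classical
  constructor
  · calc D.det.support.card
        ≤ ((Fintype.piFinset fun _ : Fin w =>
            jointSupport fun kl : Fin w × Fin w => D kl.1 kl.2).image fun g => ∑ i, g i).card := by
          refine Finset.card_le_card fun e he => ?_
          obtain ⟨g, hg, rfl⟩ := exists_sum_of_mem_support_det D he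
          exact Finset.mem_image.2 ⟨g, Fintype.mem_piFinset.2 hg, rfl⟩
      _ ≤ _ := Finset.card_image_le
      _ ≤ s ^ w := by
          rw [Fintype.card_piFinset, Finset.prod_const, Finset.card_univ, Fintype.card_fin]
          exact Nat.pow_le_pow_left hD.sparsity_le w
  · intro e he v
    obtain ⟨g, hg, rfl⟩ := exists_sum_of_mem_support_det D he
    rw [Finsupp.finsetSum_apply]
    calc ∑ i, g i v ≤ ∑ _i : Fin w, δ := Finset.sum_le_sum fun i _ => hD.degree_le _ (hg i) v
      _ = w * δ := by simp

/-! ### Monomial-separating weights modulo a prime -/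

/-- The weights `k ^ v mod p`, for some `k`, separate all pairs in a small family of pairs of
distinct monomials. -/
theorem exists_separating_weights {n D p : ℕ} (hp : p.Prime) (hD : D < p)
    (Q : Finset ((Fin n →₀ ℕ) × (Fin n →₀ ℕ)))
    (hQ : ∀ q ∈ Q, q.1 ≠ q.2 ∧ ∀ v, q.1 v ≤ D ∧ q.2 v ≤ D) (hcard : Q.card * n < p) :
    ∃ k < p, ∀ q ∈ Q, ∑ v : Fin n, q.1 v * (k ^ (v : ℕ) % p) ≠
      ∑ v : Fin n, q.2 v * (k ^ (v : ℕ) % p) := by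
  classical
  have := Fact.mk hp
  -- At `k`, this polynomial takes the difference of the two weighted sums modulo `p`. It is nonzero
  -- because exponents at most `D < p` stay distinct modulo `p`, and it has at most `n` roots. Hence
  -- fewer than `p` residues are bad for some pair.
  let P : (Fin n →₀ ℕ) × (Fin n →₀ ℕ) → Polynomial (ZMod p) := fun q =>
    ∑ v : Fin n, Polynomial.C ((q.1 v : ZMod p) - (q.2 v : ZMod p)) * Polynomial.X ^ (v : ℕ)
  have hP0 : ∀ q ∈ Q, P q ≠ 0 := by
    intro q hq h0
    obtain ⟨hne, hle⟩ := hQ q hq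
    apply hne
    ext v
    have hc : (P q).coeff v = (q.1 v : ZMod p) - (q.2 v : ZMod p) := by
      simp only [P, Polynomial.finsetSum_coeff, Polynomial.coeff_C_mul, Polynomial.coeff_X_pow]
      rw [Finset.sum_eq_single v]
      · simp
      · intro u _ hu
        rw [if_neg (fun h => hu (Fin.ext h.symm)), mul_zero]
      · simp
    rw [h0, Polynomial.coeff_zero, eq_comm, sub_eq_zero, ZMod.natCast_eq_natCast_iff'] at hc
    rwa [Nat.mod_eq_of_lt ((hle v).1.trans_lt hD), Nat.mod_eq_of_lt ((hle v).2.trans_lt hD)] at hc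
  have hPn : ∀ q, (P q).roots.toFinset.card ≤ n := by
    intro q
    refine (Multiset.toFinset_card_le _).trans ((Polynomial.card_roots' _).trans ?_)
    refine Polynomial.natDegree_sum_le_of_forall_le _ _ fun v _ => ?_
    exact (Polynomial.natDegree_C_mul_X_pow_le _ _).trans v.2.le
  obtain ⟨κ, hκ⟩ : ∃ κ : ZMod p, κ ∉ Q.biUnion fun q => (P q).roots.toFinset := by
    by_contra! h
    have h1 : (Finset.univ : Finset (ZMod p)) ⊆ Q.biUnion fun q => (P q).roots.toFinset :=
      fun κ _ => h κ
    have h2 := (Finset.card_le_card h1).trans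
      (Finset.card_biUnion_le_card_mul Q _ n fun q _ => hPn q)
    rw [Finset.card_univ, ZMod.card] at h2
    omega
  refine ⟨κ.val, ZMod.val_lt κ, fun q hq heq => hκ ?_⟩
  refine Finset.mem_biUnion.2 ⟨q, hq, ?_⟩
  rw [Multiset.mem_toFinset, Polynomial.mem_roots (hP0 q hq), Polynomial.IsRoot.def]
  have := congrArg (Nat.cast : ℕ → ZMod p) heq
  push_cast [ZMod.natCast_mod, ZMod.natCast_zmod_val] at this
  simp only [P, Polynomial.eval_finsetSum, Polynomial.eval_mul, Polynomial.eval_C,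
    Polynomial.eval_pow, Polynomial.eval_X, sub_mul, Finset.sum_sub_distrib]
  rw [this, sub_self]

/-- Substituting `T ^ c v` for the variable `x_v`, with weights `c` that separate the monomials of
`f`, gives a nonzero univariate polynomial. -/
theorem exists_univariate_of_weights {n D W : ℕ} {F K : Type*} [Field F] [Field K] [Algebra F K]
    (f : MvPolynomial (Fin n) F) (hf : f ≠ 0) (c : Fin n → ℕ)
    (hc : ∀ e ∈ f.support, ∀ e' ∈ f.support, e ≠ e' → ∑ v, e v * c v ≠ ∑ v, e' v * c v)
    (hD : ∀ e ∈ f.support, ∀ v, e v ≤ D) (hW : ∀ v, c v ≤ W) :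
    ∃ h : Polynomial K, h ≠ 0 ∧ h.natDegree ≤ n * (D * W) ∧
      ∀ t : K, h.eval t = MvPolynomial.aeval (fun v => t ^ c v) f := by
  classical
  let h : Polynomial K := ∑ e ∈ f.support,
    Polynomial.C (algebraMap F K (f.coeff e)) * Polynomial.X ^ (∑ v, e v * c v)
  refine ⟨h, ?_, ?_, ?_⟩
  · obtain ⟨e, he⟩ : f.support.Nonempty := by
      rwa [Finset.nonempty_iff_ne_empty, ne_eq, MvPolynomial.support_eq_empty]
    intro h0
    have h1 : h.coeff (∑ v, e v * c v) = algebraMap F K (f.coeff e) := by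
      simp only [h, Polynomial.finsetSum_coeff, Polynomial.coeff_C_mul, Polynomial.coeff_X_pow]
      rw [Finset.sum_eq_single e]
      · simp
      · intro e' he' hne
        rw [if_neg (hc e he e' he' hne.symm), mul_zero]
      · exact fun hn => absurd he hn
    rw [h0, Polynomial.coeff_zero] at h1
    exact MvPolynomial.mem_support_iff.1 he
      ((algebraMap F K).injective (by rw [← h1, map_zero]))
  · refine Polynomial.natDegree_sum_le_of_forall_le _ _ fun e he => ?_
    refine (Polynomial.natDegree_C_mul_X_pow_le _ _).trans ?_
    calc ∑ v, e v * c v ≤ ∑ _v : Fin n, D * W :=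
          Finset.sum_le_sum fun v _ => Nat.mul_le_mul (hD e he v) (hW v)
      _ = n * (D * W) := by simp
  · intro t
    rw [MvPolynomial.aeval_def, MvPolynomial.eval₂_eq']
    simp only [h, Polynomial.eval_finsetSum, Polynomial.eval_mul, Polynomial.eval_C,
      Polynomial.eval_pow, Polynomial.eval_X]
    refine Finset.sum_congr rfl fun e _ => ?_
    rw [← Finset.prod_pow_eq_pow_sum]
    congr 1
    refine Finset.prod_congr rfl fun v _ => ?_
    rw [← pow_mul, mul_comm]

theorem exists_index_eval_ne_zero {K : Type*} [Field K] (h : Polynomial K) (hh : h ≠ 0) {T : ℕ}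
    (hT : h.natDegree < T) (α : ℕ → K) (hα : Set.InjOn α (Set.Iio T)) :
    ∃ j < T, h.eval (α j) ≠ 0 := by
  classical
  by_contra! hno
  have hsub : (Finset.range T).image α ⊆ h.roots.toFinset := by
    intro x hx
    obtain ⟨j, hj, rfl⟩ := Finset.mem_image.1 hx
    rw [Multiset.mem_toFinset, Polynomial.mem_roots hh]
    exact hno j (Finset.mem_range.1 hj)
  have h1 := Finset.card_le_card hsub
  rw [Finset.card_image_of_injOn (by simpa using hα), Finset.card_range] at h1
  have h2 := (Multiset.toFinset_card_le h.roots).trans (Polynomial.card_roots' _)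
  omega

namespace ROABP

/-- All matrix factors of a ROABP are invertible at a point of the form `t ^ (k ^ v mod p)`. -/
theorem exists_shift {F K : Type*} [Field F] [Field K] [Algebra F K] {n w : ℕ}
    (A : ROABP F n w) {δ s μ : ℕ} (hinv : A.FactorsInvertible) (hA : A.FactorsBounded δ s μ)
    {p T : ℕ} (hp : p.Prime) (hpn : n * (s ^ w * s ^ w) * n + w * δ < p)
    (hT : n * (n * (w * δ * p)) + 1 < T) (α : ℕ → K) (hα : Set.InjOn α (Set.Iio T)) :
    ∃ k < p, ∃ j < T, α j ≠ 0 ∧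
      ∀ i, MvPolynomial.aeval (fun v : Fin n => α j ^ (k ^ (v : ℕ) % p)) (A.factor i).det ≠ 0 := by
  classical
  -- The number `d` of factors is unbounded, but at most `n` of them contain a variable; the others
  -- have constant determinants.
  let I : Finset (Fin A.d) := Finset.univ.filter fun i => ∃ v, A.block v = i.succ.castSucc
  have hI : I.card ≤ n := by
    have hsub : I.image (fun i => i.succ.castSucc) ⊆ Finset.univ.image A.block := by
      intro b hb
      obtain ⟨i, hi, rfl⟩ := Finset.mem_image.1 hb
      obtain ⟨v, hv⟩ := (Finset.mem_filter.1 hi).2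
      exact Finset.mem_image.2 ⟨v, Finset.mem_univ _, hv⟩
    have h1 := (Finset.card_le_card hsub).trans Finset.card_image_le
    rwa [Finset.card_image_of_injective _ (fun i j h => Fin.succ_injective _
      (Fin.castSucc_injective _ h)), Finset.card_univ, Fintype.card_fin] at h1
  have hb := fun i => (hA.2.1 i).det
  let Q : Finset ((Fin n →₀ ℕ) × (Fin n →₀ ℕ)) := I.biUnion fun i =>
    ((A.factor i).det.support ×ˢ (A.factor i).det.support).filter fun q => q.1 ≠ q.2
  have hQcard : Q.card ≤ n * (s ^ w * s ^ w) := by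
    refine (Finset.card_biUnion_le_card_mul I _ (s ^ w * s ^ w) fun i _ => ?_).trans
      (Nat.mul_le_mul_right _ hI)
    refine (Finset.card_filter_le _ _).trans ?_
    rw [Finset.card_product]
    exact Nat.mul_le_mul (hb i).1 (hb i).1
  obtain ⟨k, hk, hsep⟩ := exists_separating_weights (n := n) (D := w * δ) hp (by omega) Q
    (fun q hq => by
      obtain ⟨i, _, hqi⟩ := Finset.mem_biUnion.1 hq
      obtain ⟨hq1, hq2⟩ := Finset.mem_filter.1 hqi
      rw [Finset.mem_product] at hq1
      exact ⟨hq2, fun v => ⟨(hb i).2 _ hq1.1 v, (hb i).2 _ hq1.2 v⟩⟩)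
    (lt_of_le_of_lt (Nat.mul_le_mul_right _ hQcard) (by omega))
  have hh : ∀ i : Fin A.d, ∃ h : Polynomial K, i ∈ I → h ≠ 0 ∧ h.natDegree ≤ n * (w * δ * p) ∧
      ∀ t : K, h.eval t =
        MvPolynomial.aeval (fun v : Fin n => t ^ (k ^ (v : ℕ) % p)) (A.factor i).det := by
    intro i
    by_cases hi : i ∈ I
    · obtain ⟨h, hh⟩ := exists_univariate_of_weights (K := K) (W := p) (A.factor i).det (hinv i)
        (fun v : Fin n => k ^ (v : ℕ) % p)
        (fun e he e' he' hne => hsep (e, e') (Finset.mem_biUnion.2 ⟨i, hi, Finset.mem_filter.2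
          ⟨Finset.mem_product.2 ⟨he, he'⟩, hne⟩⟩)) (hb i).2
        (fun v => (Nat.mod_lt _ hp.pos).le)
      exact ⟨h, fun _ => hh⟩
    · exact ⟨0, fun h => absurd h hi⟩
  choose h hh using hh
  -- The additional factor `X` ensures `α j ≠ 0` and accounts for the `+ 1` in the degree bound.
  obtain ⟨j, hj, hne⟩ := exists_index_eval_ne_zero (Polynomial.X * ∏ i ∈ I, h i)
    (mul_ne_zero Polynomial.X_ne_zero (Finset.prod_ne_zero_iff.2 fun i hi => (hh i hi).1))
    (T := T) (by
      refine lt_of_le_of_lt (Polynomial.natDegree_mul_le.trans ?_) hT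
      rw [Polynomial.natDegree_X, add_comm]
      refine Nat.add_le_add_right ((Polynomial.natDegree_prod_le _ _).trans ?_) 1
      refine (Finset.sum_le_card_nsmul I _ _ fun i hi => (hh i hi).2.1).trans ?_
      exact Nat.mul_le_mul_right _ hI) α hα
  rw [Polynomial.eval_mul, Polynomial.eval_X, Polynomial.eval_prod] at hne
  refine ⟨k, hk, j, hj, left_ne_zero_of_mul hne, fun i => ?_⟩
  by_cases hi : i ∈ I
  · rw [← (hh i hi).2.2]
    exact Finset.prod_ne_zero_iff.1 (right_ne_zero_of_mul hne) i hi
  -- A factor whose block is empty has a nonzero constant determinant, which no evaluation can kill.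
  · have hzero : ∀ e ∈ (A.factor i).det.support, e = 0 := by
      intro e he
      obtain ⟨g, hg, rfl⟩ := exists_sum_of_mem_support_det _ he
      refine Finset.sum_eq_zero fun l _ => ?_
      obtain ⟨kl, _, hkl⟩ := Finset.mem_biUnion.1 (hg l)
      ext v
      by_contra hv
      refine hi (Finset.mem_filter.2 ⟨Finset.mem_univ _, v, A.factor_vars i kl.1 kl.2 v ?_⟩)
      exact (MvPolynomial.mem_vars_iff_mem_support v).2 ⟨g l, hkl, Finsupp.mem_support_iff.2 hv⟩
    obtain ⟨e, he⟩ : (A.factor i).det.support.Nonempty := by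
      rw [Finset.nonempty_iff_ne_empty, ne_eq, MvPolynomial.support_eq_empty]
      exact hinv i
    have hs : (A.factor i).det.support = {0} := by
      ext e'
      rw [Finset.mem_singleton]
      exact ⟨hzero e', fun h => by rw [h, ← hzero e he]; exact he⟩
    rw [MvPolynomial.aeval_def, MvPolynomial.eval₂_eq', hs, Finset.sum_singleton]
    have h0 : (0 : Fin n →₀ ℕ) ∈ (A.factor i).det.support := by simp [hs]
    simpa using MvPolynomial.mem_support_iff.1 h0

end ROABP

/-! ### The points of the hitting-set -/

/-- The weight of the `v`-th variable, equal to `k ^ v mod q` for `q > 1`. -/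
def weight (q k : ℕ) : ℕ → ℕ
  | 0 => 1
  | v + 1 => weight q k v * k % q

theorem weight_eq {q : ℕ} (hq : 1 < q) (k v : ℕ) : weight q k v = k ^ v % q := by
  induction v with
  | zero => simp [weight, Nat.mod_eq_of_lt hq]
  | succ v ih => rw [weight, ih, pow_succ, Nat.mod_mul_mod]

theorem weight_le {q : ℕ} (hq : 0 < q) (k v : ℕ) : weight q k v ≤ q := by
  cases v with
  | zero => exact hq
  | succ v => exact (Nat.mod_lt _ hq).le

section points

variable {K : Type*} (α : ℕ → K)

/-- Change `r` coordinates as prescribed by the digits of `x` to base `M`. -/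
def overwrite (M : ℕ) : ℕ → ℕ → (ℕ → K) → ℕ → K
  | 0, _, h => h
  | r + 1, x, h => overwrite M r (x / M / M) (Function.update h (x % M) (α (x / M % M)))

/-- The field heap agrees with the base point at addresses below `n` only; further cells may contain
remnants of earlier points. -/
theorem overwrite_congr (M r x : ℕ) {n : ℕ} {h h' : ℕ → K} (hh : ∀ v < n, h v = h' v) :
    ∀ v < n, overwrite α M r x h v = overwrite α M r x h' v := by
  induction r generalizing x h h' with
  | zero => exact hh
  | succ r ih =>
    refine ih _ fun v hv => ?_
    by_cases hx : v = x % M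
    · subst hx; simp
    · simp [Function.update_of_ne hx, hh v hv]

theorem add_mul_lt_mul {a M b c : ℕ} (ha : a < M) (hb : b < c) : a + M * b < M * c := by
  calc a + M * b < M + M * b := by omega
    _ = M * (b + 1) := by ring
    _ ≤ M * c := Nat.mul_le_mul_left _ hb

theorem exists_overwrite {n M : ℕ} (hn : n < M) (j : Fin n → ℕ) (hj : ∀ v, j v < M) (r : ℕ)
    (R : Finset (Fin n)) (hR : R.card ≤ r) (h : ℕ → K) :
    ∃ x < (M * M) ^ r, ∀ v : Fin n,
      overwrite α M r x h v = if v ∈ R then α (j v) else h v := by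
  classical
  induction r generalizing R h with
  | zero =>
    have : R = ∅ := by simpa using hR
    subst this
    exact ⟨0, by simp, fun v => by simp [overwrite]⟩
  | succ r ih =>
    have hM : 0 < M := by omega
    have key : ∀ u i : ℕ, u < M → i < M → ∀ R' : Finset (Fin n), R'.card ≤ r →
        (∀ v : Fin n, (if v ∈ R' then α (j v) else Function.update h u (α i) v) =
          if v ∈ R then α (j v) else h v) →
        ∃ x < (M * M) ^ (r + 1), ∀ v : Fin n,
          overwrite α M (r + 1) x h v = if v ∈ R then α (j v) else h v := by
      intro u i hu hi R' hR' heq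
      obtain ⟨x, hx, hxo⟩ := ih R' hR' (Function.update h u (α i))
      refine ⟨u + M * (i + M * x), ?_, fun v => ?_⟩
      · rw [pow_succ', mul_assoc]
        exact add_mul_lt_mul hu (add_mul_lt_mul hi hx)
      · rw [overwrite, Nat.add_mul_mod_self_left, Nat.mod_eq_of_lt hu, Nat.add_mul_div_left _ _ hM,
          Nat.div_eq_of_lt hu, zero_add, Nat.add_mul_mod_self_left, Nat.mod_eq_of_lt hi,
          Nat.add_mul_div_left _ _ hM, Nat.div_eq_of_lt hi, zero_add, hxo, heq]
    rcases R.eq_empty_or_nonempty with rfl | ⟨u, hu⟩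
    -- When fewer than `r` coordinates have to change, the surplus writes go to address `n`, just
    -- beyond the point; it is a legal digit because `n < M`.
    · refine key n 0 hn hM ∅ (by simp) fun v => ?_
      simp [Function.update_of_ne v.2.ne]
    · refine key u (j u) (u.2.trans hn) (hj u) (R.erase u) ?_ fun v => ?_
      · rw [Finset.card_erase_of_mem hu]
        omega
      · by_cases hv : v = u
        · subst hv
          simp [hu]
        · have : (v : ℕ) ≠ u := fun h => hv (Fin.ext h)
          simp [hv, Function.update_of_ne this]

variable [Field K]

/-- The point `(t ^ weight q k v)_v` given by the three lowest digits of `x` to base `B`. -/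
def basePoint (B x v : ℕ) : K :=
  α (x % B) ^ weight (x / B % B + 1) (x / B / B % B) v

/-- The `x`-th point of the hitting-set. -/
def point (B M r x : ℕ) : ℕ → K :=
  overwrite α M r (x / B / B / B) (basePoint α B x)

/-- The digit `q` encodes the modulus `q + 1`, so no number `x` leads to a division by zero in the
program. -/
theorem exists_point {n B M r t q k : ℕ} (hn : n < M) (ht : t < B) (hq : q < B) (hk : k < B)
    (j : Fin n → ℕ) (hj : ∀ v, j v < M) (R : Finset (Fin n)) (hR : R.card ≤ r) :
    ∃ x < B * (B * (B * (M * M) ^ r)), ∀ v : Fin n,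
      point α B M r x v = if v ∈ R then α (j v) else α t ^ weight (q + 1) k v := by
  have hB : 0 < B := by omega
  obtain ⟨x, hx, hxo⟩ := exists_overwrite α hn j hj r R hR fun v => α t ^ weight (q + 1) k v
  have h1 : ∀ a b, a < B → (a + B * b) % B = a ∧ (a + B * b) / B = b := fun a b ha => by
    rw [Nat.add_mul_mod_self_left, Nat.mod_eq_of_lt ha, Nat.add_mul_div_left _ _ hB,
      Nat.div_eq_of_lt ha, zero_add]
    exact ⟨rfl, rfl⟩
  refine ⟨t + B * (q + B * (k + B * x)),
    add_mul_lt_mul ht (add_mul_lt_mul hq (add_mul_lt_mul hk hx)), fun v => ?_⟩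
  have hbase : basePoint α B (t + B * (q + B * (k + B * x))) =
      fun v => α t ^ weight (q + 1) k v := by
    funext v
    rw [basePoint, (h1 _ _ ht).1, (h1 _ _ ht).2, (h1 _ _ hq).1, (h1 _ _ hq).2, (h1 _ _ hk).1]
  rw [point, hbase, (h1 _ _ ht).2, (h1 _ _ hq).2, (h1 _ _ hk).2]
  exact hxo v

/-- The points `point α B M r x` form a hitting-set. -/
theorem isHittingSet_points {F : Type*} [Field F] [Algebra F K] {n w δ s μ c B M : ℕ}
    (hn : n < M) (hδ : δ < M) (hMB : M ≤ B) (hs : s ≤ 2 ^ c) (hα : Set.InjOn α (Set.Iio B))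
    {N : ℕ} (hN : N = n * (s ^ w * s ^ w) * n + w * δ) (hN0 : N ≠ 0) (hNB : 2 * N ≤ B)
    (hTB : n * (n * (w * δ * (2 * N))) + 1 < B) {H : Set (Fin n → K)}
    (hH : ∀ x < B * (B * (B * (M * M) ^ ((w ^ 2 + 2) * min c μ))),
      (fun v : Fin n => point α B M ((w ^ 2 + 2) * min c μ) x v) ∈ H) :
    IsHittingSet H (polyClass F n w δ s μ) := by
  classical
  rintro _ ⟨A, hinv, hA, rfl⟩ hne
  -- Bertrand's postulate places a suitable prime below `B`. The program tries all moduli and so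
  -- never tests primality.
  obtain ⟨p, hp, hpN, hp2⟩ := Nat.exists_prime_lt_and_le_two_mul N hN0
  obtain ⟨k, hk, t, ht, ht0, hdet⟩ := A.exists_shift hinv hA hp (hN ▸ hpN) (T := B)
    (lt_of_le_of_lt (by gcongr) hTB) α hα
  have hinj : Set.InjOn α (Finset.range (δ + 1) : Set ℕ) := hα.mono fun i hi => by
    simp only [Finset.coe_range, Set.mem_Iio] at hi ⊢
    omega
  obtain ⟨z, R, hR, hz, hza, hzG⟩ := A.exists_aeval_ne_zero_near hA hs
    (fun v : Fin n => α t ^ (k ^ (v : ℕ) % p)) (fun v => pow_ne_zero _ ht0) hdet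
    ((Finset.range (δ + 1)).image α)
    (by rw [Finset.card_image_of_injOn hinj, Finset.card_range]; exact Nat.lt_succ_self δ) hne
  have hj : ∀ v, ∃ j < M, v ∈ R → α j = z v := fun v => by
    by_cases hv : v ∈ R
    · obtain ⟨j, hj, hjz⟩ := Finset.mem_image.1 (hzG v hv)
      exact ⟨j, by rw [Finset.mem_range] at hj; omega, fun _ => hjz⟩
    · exact ⟨0, by omega, fun h => absurd h hv⟩
  choose j hjM hjz using hj
  obtain ⟨x, hx, hxz⟩ := exists_point α (q := p - 1) hn ht (by have := hp.pos; omega)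
    (hk.trans_le (by omega)) j hjM R hR
  refine ⟨_, hH x hx, ?_⟩
  have hzx : (fun v : Fin n => point α B M ((w ^ 2 + 2) * min c μ) x v) = z := by
    funext v
    rw [hxz v]
    split_ifs with hv
    · exact hjz v hv
    · rw [hza v hv, Nat.sub_add_cancel hp.pos, weight_eq hp.one_lt]
  rw [hzx]
  exact hz

/-- For a single variable, `δ + 1` points suffice. -/
theorem isHittingSet_univariate {F : Type*} [Field F] [Algebra F K] {w δ s μ : ℕ} (hδ : 1 ≤ δ)
    (hα : Set.InjOn α (Set.Iio (δ + 1))) {H : Set (Fin 1 → K)}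
    (hH : ∀ j < δ + 1, (fun _ => α j) ∈ H) :
    IsHittingSet H (polyClass F 1 w δ s μ) := by
  classical
  rintro _ ⟨A, -, hA, rfl⟩ hne
  let E := AlgebraicClosure K
  obtain ⟨y, hy⟩ := ROABP.exists_aeval_ne_zero (E := E) A.poly hne
  have hinj : Function.Injective (algebraMap K E) := (algebraMap K E).injective
  obtain ⟨i, hi, hi0⟩ : ∃ i < δ + 1, α i ≠ 0 := by
    by_contra! h
    have := hα (by simp) (by simp; omega) ((h 0 (by omega)).trans (h 1 (by omega)).symm)
    exact zero_ne_one this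
  have hG : δ < (((Finset.range (δ + 1)).image α).image (algebraMap K E)).card := by
    rw [Finset.card_image_of_injective _ hinj, Finset.card_image_of_injOn (by simpa using hα),
      Finset.card_range]
    exact Nat.lt_succ_self δ
  -- With all blocks changed, the single coordinate is either the nonzero base value `α i` or one of
  -- the `δ + 1` grid values. The number of changes is irrelevant here, so `s ≤ 2 ^ s` is good
  -- enough and invertibility plays no role.
  obtain ⟨z, R, -, hz, -, hz2, hz3⟩ := A.exists_nonzero_near hA (Nat.lt_two_pow_self (n := s)).le
    (fun _ => algebraMap K E (α i)) (fun _ h => hi0 (hinj (by simpa using h))) _ hG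
    Finset.univ y hy
  obtain ⟨j, hj, hjz⟩ : ∃ j < δ + 1, algebraMap K E (α j) = z 0 := by
    by_cases h0 : (0 : Fin 1) ∈ R
    · simpa using (hz3 0 h0).2
    · exact ⟨i, hi, (hz2 0 (Finset.mem_univ _) h0).symm⟩
  refine ⟨_, hH j hj, fun h => hz ?_⟩
  have hzj : z = fun _ : Fin 1 => algebraMap K E (α j) := by
    funext v
    rw [Subsingleton.elim v 0, hjz]
  have := MvPolynomial.aeval_algebraMap_apply (A := K) E (fun _ : Fin 1 => α j) A.poly
  rw [h, map_zero] at this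
  rw [hzj]
  exact this

end points

/-! ### Trivial inputs: no variables, width zero, sparsity zero -/

/-- Without variables, the only point suffices. -/
theorem isHittingSet_of_isEmpty {F K : Type*} [Field F] [Field K] [Algebra F K] {w δ s μ : ℕ}
    {H : Set (Fin 0 → K)} (hH : H.Nonempty) : IsHittingSet H (polyClass F 0 w δ s μ) := by
  obtain ⟨a, ha⟩ := hH
  intro C _ hC
  refine ⟨a, ha, fun h => hC ?_⟩
  rw [MvPolynomial.eq_C_of_isEmpty C] at h ⊢
  rw [MvPolynomial.aeval_C, map_eq_zero] at h
  rw [h, map_zero]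

theorem poly_eq_zero_of_width_zero {F : Type*} [Field F] {n δ s μ : ℕ}
    {C : MvPolynomial (Fin n) F} (hC : C ∈ polyClass F n 0 δ s μ) : C = 0 := by
  obtain ⟨A, -, -, rfl⟩ := hC
  simp [ROABP.poly, dotProduct]

theorem poly_eq_zero_of_sparsity_zero {F : Type*} [Field F] {n w δ μ : ℕ}
    {C : MvPolynomial (Fin n) F} (hC : C ∈ polyClass F n w δ 0 μ) : C = 0 := by
  obtain ⟨A, -, hA, rfl⟩ := hC
  have h0 : ∀ k, A.left k = 0 := by
    intro k
    have h := Finset.card_eq_zero.1 (Nat.le_zero.1 hA.1.sparsity_le)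
    rw [← MvPolynomial.support_eq_empty, Finset.eq_empty_iff_forall_notMem]
    intro e he
    exact Finset.notMem_empty e (h ▸ Finset.mem_biUnion.2 ⟨k, Finset.mem_univ _, he⟩)
  simp [ROABP.poly, dotProduct, h0]

/-! ### Verification of programs with time bounds -/

section runs

variable {K : Type*} [Field K] (α : ℕ → K)

/-- Started in `σ`, the program `P` halts within `T` steps in a state satisfying `Q`. -/
def Runs (P : Prog) (σ : State K) (T : ℕ) (Q : State K → Prop) : Prop :=
  ∃ t τ, Exec α P σ t τ ∧ t ≤ T ∧ Q τ

variable {α}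

theorem Runs.mono {P : Prog} {σ : State K} {T T' : ℕ} {Q Q' : State K → Prop}
    (h : Runs α P σ T Q) (hT : T ≤ T') (hQ : ∀ τ, Q τ → Q' τ) : Runs α P σ T' Q' := by
  obtain ⟨t, τ, h1, h2, h3⟩ := h
  exact ⟨t, τ, h1, h2.trans hT, hQ τ h3⟩

theorem Runs.skip {σ : State K} {Q : State K → Prop} (h : Q σ) : Runs α .skip σ 0 Q :=
  ⟨0, σ, .skip σ, le_rfl, h⟩

theorem Runs.instr {I : Instr} {σ : State K} {Q : State K → Prop} (h : Q (I.step α σ)) :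
    Runs α (.instr I) σ 1 Q :=
  ⟨1, _, .instr I σ, le_rfl, h⟩

theorem Runs.seq {P P' : Prog} {σ : State K} {T T' : ℕ} {Q Q' : State K → Prop}
    (h : Runs α P σ T Q) (h' : ∀ ρ, Q ρ → Runs α P' ρ T' Q') :
    Runs α (.seq P P') σ (T + T') Q' := by
  obtain ⟨t, ρ, h1, h2, h3⟩ := h
  obtain ⟨t', τ, h1', h2', h3'⟩ := h' ρ h3
  exact ⟨t + t', τ, .seq h1 h1', by omega, h3'⟩

theorem Runs.instr_seq {I : Instr} {P : Prog} {σ : State K} {T : ℕ} {Q : State K → Prop}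
    (h : Runs α P (I.step α σ) T Q) : Runs α (.seq (.instr I) P) σ (1 + T) Q :=
  Runs.seq (Q := fun ρ => ρ = I.step α σ) (Runs.instr rfl) fun _ hρ => hρ ▸ h

theorem Runs.ite {x y : ℕ} {P P' : Prog} {σ : State K} {T : ℕ} {Q : State K → Prop}
    (h : σ.reg x < σ.reg y → Runs α P σ T Q) (h' : ¬ σ.reg x < σ.reg y → Runs α P' σ T Q) :
    Runs α (.ifLT x y P P') σ (T + 1) Q := by
  by_cases hlt : σ.reg x < σ.reg y
  · obtain ⟨t, τ, h1, h2, h3⟩ := h hlt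
    exact ⟨t + 1, τ, .ifTrue hlt h1, by omega, h3⟩
  · obtain ⟨t, τ, h1, h2, h3⟩ := h' hlt
    exact ⟨t + 1, τ, .ifFalse hlt h1, by omega, h3⟩

/-- A loop with an invariant `I i` before the `i`-th iteration, and at most `N` iterations. -/
theorem Runs.while {x y : ℕ} {P : Prog} {σ : State K} {c : ℕ} {Q : State K → Prop} (N : ℕ)
    (I : ℕ → State K → Prop) (h0 : I 0 σ)
    (hstep : ∀ i ρ, I i ρ → ρ.reg x < ρ.reg y → i < N ∧ Runs α P ρ c (I (i + 1)))
    (hend : ∀ i ρ, I i ρ → ¬ ρ.reg x < ρ.reg y → Q ρ) :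
    Runs α (.whileLT x y P) σ (N * (c + 1) + 1) Q := by
  -- The induction is on a bound `m` for the number of iterations that remain.
  have key : ∀ m i ρ, N ≤ i + m → I i ρ →
      Runs α (.whileLT x y P) ρ (m * (c + 1) + 1) Q := by
    intro m
    induction m with
    | zero =>
      intro i ρ hi hI
      have hlt : ¬ ρ.reg x < ρ.reg y := fun hlt => by
        have := (hstep i ρ hI hlt).1
        omega
      exact ⟨1, ρ, .whileFalse hlt, by omega, hend i ρ hI hlt⟩
    | succ m ih =>
      intro i ρ hi hI
      by_cases hlt : ρ.reg x < ρ.reg y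
      · obtain ⟨t, ρ', h1, h2, h3⟩ := (hstep i ρ hI hlt).2
        obtain ⟨t', τ, h1', h2', h3'⟩ := ih (i + 1) ρ' (by omega) h3
        exact ⟨t + t' + 1, τ, .whileTrue hlt h1 h1', by rw [add_mul]; omega, h3'⟩
      · exact ⟨1, ρ, .whileFalse hlt, by omega, hend i ρ hI hlt⟩
  exact key N 0 σ (by omega) h0

/-- The states `σ` and `τ` agree except for the registers in `S`. -/
structure Frame (S : List ℕ) (σ τ : State K) : Prop where
  reg : ∀ r, r ∉ S → τ.reg r = σ.reg r
  freg : τ.freg = σ.freg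
  fheap : τ.fheap = σ.fheap
  output : τ.output = σ.output

end runs

/-! ### Arithmetic subroutines

Register `5` holds `0` and register `6` holds `1`. -/

/-- `x := y * z`, with a counter `t`. -/
def mulProg (x y z t : ℕ) : Prog :=
  .seq (.instr (.const x 0)) (.seq (.instr (.const t 0))
    (.whileLT t z (.seq (.instr (.add x x y)) (.instr (.add t t 6)))))

/-- `(x, q) := (x mod y, x div y)`. -/
def divModProg (x y q : ℕ) : Prog :=
  .seq (.instr (.const q 0)) (.seq (.instr (.add x x 6)) (.seq
    (.whileLT y x (.seq (.instr (.sub x x y)) (.instr (.add q q 6))))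
    (.instr (.sub x x 6))))

/-- `x := y ^ z`, with counters and temporary registers `t, u, u'`. -/
def powProg (x y z t u u' : ℕ) : Prog :=
  .seq (.instr (.const x 1)) (.seq (.instr (.const t 0))
    (.whileLT t z (.seq (mulProg u x y u') (.seq (.instr (.add x u 5)) (.instr (.add t t 6))))))

/-- `(d, x) := (x mod y, x div y)`. -/
def digitProg (d x y : ℕ) : Prog :=
  .seq (.instr (.add d x 5)) (divModProg d y x)

section subroutines

variable {K : Type*} [Field K] {α : ℕ → K}

/-- Repeated addition costs time proportional to the value of the multiplier. This is affordable
because multipliers in the program never exceed the number of points. -/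
theorem runs_mulProg {x y z t : ℕ} (hl : [x, y, z, t, 6].Nodup) {σ : State K}
    (h6 : σ.reg 6 = 1) :
    Runs α (mulProg x y z t) σ (σ.reg z * 3 + 3) fun τ =>
      τ.reg x = σ.reg y * σ.reg z ∧ Frame [x, t] σ τ := by
  simp only [List.nodup_cons, List.mem_cons, List.not_mem_nil, not_or, or_false] at hl
  obtain ⟨⟨hxy, hxz, hxt, hx6⟩, ⟨hyz, hyt, hy6⟩, ⟨hzt, hz6⟩, ht6, -⟩ := hl
  refine Runs.mono (Runs.instr_seq (Runs.instr_seq (Runs.while (σ.reg z)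
    (fun i ρ => ρ.reg x = σ.reg y * i ∧ ρ.reg t = i ∧ i ≤ σ.reg z ∧ Frame [x, t] σ ρ)
    (c := 1 + 1) (Q := fun τ => τ.reg x = σ.reg y * σ.reg z ∧ Frame [x, t] σ τ)
    ?_ ?_ ?_))) (by omega) fun _ h => h
  · simp only [Instr.step]
    refine ⟨by simp [hxt], by simp, by omega, ⟨fun r hr => ?_, rfl, rfl, rfl⟩⟩
    simp only [List.mem_cons, List.not_mem_nil, not_or, or_false] at hr
    simp [hr.1, hr.2]
  · rintro i ρ ⟨h1, h2, h3, h4⟩ hlt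
    have hz : ρ.reg z = σ.reg z := h4.reg z (by simp [Ne.symm hxz, hzt])
    have hy : ρ.reg y = σ.reg y := h4.reg y (by simp [Ne.symm hxy, hyt])
    have h6' : ρ.reg 6 = 1 := (h4.reg 6 (by simp [Ne.symm hx6, Ne.symm ht6])).trans h6
    rw [h2, hz] at hlt
    refine ⟨hlt, Runs.instr_seq (Runs.instr ?_)⟩
    simp only [Instr.step]
    refine ⟨by simp [hxt, h1, hy, mul_add], by simp [Ne.symm hxt, h2, Ne.symm hx6, h6'], by omega,
      ⟨fun r hr => ?_, h4.freg, h4.fheap, h4.output⟩⟩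
    have hr' := hr
    simp only [List.mem_cons, List.not_mem_nil, not_or, or_false] at hr
    simp [hr.1, hr.2, h4.reg r hr']
  · rintro i ρ ⟨h1, h2, h3, h4⟩ hlt
    rw [h2, h4.reg z (by simp [Ne.symm hxz, hzt])] at hlt
    have : i = σ.reg z := by omega
    exact ⟨this ▸ h1, h4⟩

theorem runs_divModProg {x y q : ℕ} (hl : [x, y, q, 6].Nodup) {σ : State K}
    (h6 : σ.reg 6 = 1) (hy0 : 0 < σ.reg y) :
    Runs α (divModProg x y q) σ (σ.reg x * 3 + 4) fun τ =>
      τ.reg x = σ.reg x % σ.reg y ∧ τ.reg q = σ.reg x / σ.reg y ∧ Frame [x, q] σ τ := by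
  simp only [List.nodup_cons, List.mem_cons, List.not_mem_nil, not_or, or_false] at hl
  obtain ⟨⟨hxy, hxq, hx6⟩, ⟨hyq, hy6⟩, hq6, -⟩ := hl
  -- The dividend is raised by one for the duration of the loop, so that the strict test `y < x`
  -- decides `y ≤ x` for the true remainder. This is the `+ 1` in the invariant, undone by the last
  -- subtraction.
  refine Runs.mono (Runs.instr_seq (Runs.instr_seq (Runs.seq (Runs.while (σ.reg x)
    (fun i ρ => ρ.reg x + σ.reg y * i = σ.reg x + 1 ∧ 0 < ρ.reg x ∧ ρ.reg q = i ∧ i ≤ σ.reg x ∧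
      Frame [x, q] σ ρ) (c := 1 + 1)
    (Q := fun ρ => ρ.reg x = σ.reg x % σ.reg y + 1 ∧ ρ.reg q = σ.reg x / σ.reg y ∧
      Frame [x, q] σ ρ) ?_ ?_ ?_)
    fun ρ hρ => Runs.instr (Q := fun τ => τ.reg x = σ.reg x % σ.reg y ∧
      τ.reg q = σ.reg x / σ.reg y ∧ Frame [x, q] σ τ) ?_)))
    (by omega) fun _ h => h
  · simp only [Instr.step]
    refine ⟨by simp [hxq, Ne.symm hq6, h6], by simp [hxq, Ne.symm hq6, h6],
      by simp [Ne.symm hxq], by omega, ⟨fun r hr => ?_, rfl, rfl, rfl⟩⟩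
    simp only [List.mem_cons, List.not_mem_nil, not_or, or_false] at hr
    simp [hr.1, hr.2]
  · rintro i ρ ⟨h1, h2, h3, h4, h5⟩ hlt
    have hy : ρ.reg y = σ.reg y := h5.reg y (by simp [Ne.symm hxy, hyq])
    have h6' : ρ.reg 6 = 1 := (h5.reg 6 (by simp [Ne.symm hx6, Ne.symm hq6])).trans h6
    rw [hy] at hlt
    have hi : i < σ.reg x := by
      have : i ≤ σ.reg y * i := Nat.le_mul_of_pos_left i hy0
      omega
    refine ⟨hi, Runs.instr_seq (Runs.instr ?_)⟩
    simp only [Instr.step]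
    refine ⟨?_, by simp [hxq, hy]; omega, by simp [Ne.symm hxq, h3, Ne.symm hx6, h6'], by omega,
      ⟨fun r hr => ?_, h5.freg, h5.fheap, h5.output⟩⟩
    · simp [hxq, hy, mul_add]
      omega
    · have hr' := hr
      simp only [List.mem_cons, List.not_mem_nil, not_or, or_false] at hr
      simp [hr.1, hr.2, h5.reg r hr']
  · rintro i ρ ⟨h1, h2, h3, h4, h5⟩ hlt
    rw [h5.reg y (by simp [Ne.symm hxy, hyq])] at hlt
    have hx : σ.reg x = (ρ.reg x - 1) + σ.reg y * i := by omega
    have hlt' : ρ.reg x - 1 < σ.reg y := by omega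
    refine ⟨?_, ?_, h5⟩
    · rw [hx, Nat.add_mul_mod_self_left, Nat.mod_eq_of_lt hlt']
      omega
    · rw [hx, Nat.add_mul_div_left _ _ hy0, Nat.div_eq_of_lt hlt', h3, zero_add]
  · obtain ⟨h1, h2, h3⟩ := hρ
    have h6' : ρ.reg 6 = 1 := (h3.reg 6 (by simp [Ne.symm hx6, Ne.symm hq6])).trans h6
    simp only [Instr.step]
    refine ⟨by simp [h1, h6'], by simp [Ne.symm hxq, h2],
      ⟨fun r hr => ?_, h3.freg, h3.fheap, h3.output⟩⟩
    have hr' := hr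
    simp only [List.mem_cons, List.not_mem_nil, not_or, or_false] at hr
    simp [hr.1, h3.reg r hr']

theorem runs_digitProg {d x y : ℕ} (hl : [d, y, x, 6].Nodup) {σ : State K}
    (h5 : σ.reg 5 = 0) (h6 : σ.reg 6 = 1) (hy0 : 0 < σ.reg y) :
    Runs α (digitProg d x y) σ (σ.reg x * 3 + 5) fun τ =>
      τ.reg d = σ.reg x % σ.reg y ∧ τ.reg x = σ.reg x / σ.reg y ∧ Frame [d, x] σ τ := by
  have hl' := hl
  simp only [List.nodup_cons, List.mem_cons, List.not_mem_nil, not_or, or_false] at hl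
  obtain ⟨⟨hdy, hdx, hd6⟩, ⟨hyx, hy6⟩, hx6, -⟩ := hl
  have e1 : ((Instr.add d x 5).step α σ).reg d = σ.reg x := by simp [Instr.step, h5]
  have e2 : ∀ r, r ≠ d → ((Instr.add d x 5).step α σ).reg r = σ.reg r := fun r hr => by
    simp [Instr.step, hr]
  refine Runs.mono (Runs.instr_seq (runs_divModProg hl' (by rw [e2 6 (Ne.symm hd6), h6])
    (by rwa [e2 y (Ne.symm hdy)]))) (by rw [e1]; omega) ?_
  rintro τ ⟨h1, h2, h3⟩
  rw [e1, e2 y (Ne.symm hdy)] at h1 h2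
  refine ⟨h1, h2, ⟨fun r hr => ?_, h3.freg, h3.fheap, h3.output⟩⟩
  rw [h3.reg r hr, e2 r fun h => hr (by simp [h])]

/-- The base is the multiplier in every round, so a round costs time linear in the base and not in
the growing power. -/
theorem runs_powProg {x y z t u u' : ℕ} (hl : [x, y, z, t, u, u', 5, 6].Nodup) {σ : State K}
    (h5 : σ.reg 5 = 0) (h6 : σ.reg 6 = 1) :
    Runs α (powProg x y z t u u') σ (σ.reg z * (σ.reg y * 3 + 6) + 3) fun τ =>
      τ.reg x = σ.reg y ^ σ.reg z ∧ Frame [x, t, u, u'] σ τ := by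
  have hmul : [u, x, y, u', 6].Nodup := by
    simp only [List.nodup_cons, List.mem_cons, List.not_mem_nil, not_or, or_false] at hl ⊢
    tauto
  simp only [List.nodup_cons, List.mem_cons, List.not_mem_nil, not_or, or_false] at hl
  obtain ⟨⟨hxy, hxz, hxt, hxu, hxu', hx5, hx6⟩, ⟨hyz, hyt, hyu, hyu', hy5, hy6⟩,
    ⟨hzt, hzu, hzu', hz5, hz6⟩, ⟨htu, htu', ht5, ht6⟩, ⟨huu', hu5, hu6⟩, ⟨hu5', hu6'⟩, -⟩ := hl
  refine Runs.mono (Runs.instr_seq (Runs.instr_seq (Runs.while (σ.reg z)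
    (fun i ρ => ρ.reg x = σ.reg y ^ i ∧ ρ.reg t = i ∧ i ≤ σ.reg z ∧ Frame [x, t, u, u'] σ ρ)
    (c := (σ.reg y * 3 + 3) + (1 + 1))
    (Q := fun τ => τ.reg x = σ.reg y ^ σ.reg z ∧ Frame [x, t, u, u'] σ τ)
    ?_ ?_ ?_))) (by rw [show σ.reg y * 3 + 3 + (1 + 1) + 1 = σ.reg y * 3 + 6 from rfl]; omega)
    fun _ h => h
  · simp only [Instr.step]
    refine ⟨by simp [hxt], by simp, by omega, ⟨fun r hr => ?_, rfl, rfl, rfl⟩⟩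
    simp only [List.mem_cons, List.not_mem_nil, not_or, or_false] at hr
    simp [hr.1, hr.2]
  · rintro i ρ ⟨h1, h2, h3, h4⟩ hlt
    have hz : ρ.reg z = σ.reg z := h4.reg z (by simp [Ne.symm hxz, hzt, hzu, hzu'])
    have hy : ρ.reg y = σ.reg y := h4.reg y (by simp [Ne.symm hxy, hyt, hyu, hyu'])
    have h5' : ρ.reg 5 = 0 := (h4.reg 5 (by
      simp [Ne.symm hx5, Ne.symm ht5, Ne.symm hu5, Ne.symm hu5'])).trans h5
    have h6' : ρ.reg 6 = 1 := (h4.reg 6 (by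
      simp [Ne.symm hx6, Ne.symm ht6, Ne.symm hu6, Ne.symm hu6'])).trans h6
    rw [h2, hz] at hlt
    refine ⟨hlt, Runs.seq (Runs.mono (runs_mulProg hmul h6') (by rw [hy]) fun _ h => h) ?_⟩
    rintro ρ' ⟨h7, h8⟩
    refine Runs.instr_seq (Runs.instr ?_)
    have f5 : ρ'.reg 5 = 0 := (h8.reg 5 (by simp [Ne.symm hu5, Ne.symm hu5'])).trans h5'
    have f6 : ρ'.reg 6 = 1 := (h8.reg 6 (by simp [Ne.symm hu6, Ne.symm hu6'])).trans h6'
    have ft : ρ'.reg t = i := (h8.reg t (by simp [htu, htu'])).trans h2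
    simp only [Instr.step]
    refine ⟨by simp [hxt, h7, h1, hy, f5, pow_succ], by simp [Ne.symm hxt, ft, Ne.symm hx6, f6],
      by omega, ⟨fun r hr => ?_, h8.freg.trans h4.freg, h8.fheap.trans h4.fheap,
        h8.output.trans h4.output⟩⟩
    have hr' := hr
    simp only [List.mem_cons, List.not_mem_nil, not_or, or_false] at hr
    simp [hr.1, hr.2.1, h8.reg r (by simp [hr.2.2.1, hr.2.2.2]), h4.reg r hr']
  · rintro i ρ ⟨h1, h2, h3, h4⟩ hlt
    rw [h2, h4.reg z (by simp [Ne.symm hxz, hzt, hzu, hzu'])] at hlt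
    have : i = σ.reg z := by omega
    exact ⟨this ▸ h1, h4⟩

end subroutines

/-! ### The program that computes the points

Registers `0, …, 4` hold the input; from the setup on, the registers `11`, `13`, `14`, `16` hold
the base `M`, the base `B`, the number `r` of changed coordinates and the number `N` of points.
Registers from `17` on are used in the main loop: `17` counts the points, `18` holds the remaining
digits. -/

/-- field register `1` := (field register `0`) ^ (register `22`) -/
def fpowProg : Prog :=
  .seq (.instr (.fone 1)) (.seq (.instr (.const 24 0))
    (.whileLT 24 22 (.seq (.instr (.fmul 1 1 0)) (.instr (.add 24 24 6)))))

/-- Write the powers of field register `0` with exponents `weight q k v`, where registers `20` and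
`21` hold `q` and `k`. -/
def baseProg : Prog :=
  .seq (.instr (.const 22 1)) (.seq (.instr (.const 23 0))
    (.whileLT 23 0 (.seq fpowProg (.seq (.instr (.fstore 23 1)) (.seq (mulProg 25 22 21 24)
      (.seq (digitProg 22 25 20) (.instr (.add 23 23 6))))))))

/-- Change `r` coordinates. -/
def overwriteProg : Prog :=
  .seq (.instr (.const 23 0))
    (.whileLT 23 14 (.seq (digitProg 24 18 11) (.seq (digitProg 25 18 11)
      (.seq (.instr (.felem 1 25)) (.seq (.instr (.fstore 24 1)) (.instr (.add 23 23 6)))))))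

/-- Output the first `n` entries of the field heap. -/
def outputProg : Prog :=
  .seq (.instr (.const 23 0))
    (.whileLT 23 0 (.seq (.instr (.fload 1 23)) (.seq (.instr (.out 1)) (.instr (.add 23 23 6)))))

/-- Compute and output the point with the number in register `17`, and increment this number. -/
def pointProg : Prog :=
  .seq (.instr (.add 18 17 5)) (.seq (digitProg 19 18 13) (.seq (.instr (.felem 0 19))
    (.seq (digitProg 20 18 13) (.seq (.instr (.add 20 20 6)) (.seq (digitProg 21 18 13)
      (.seq baseProg (.seq overwriteProg (.seq outputProg (.instr (.add 17 17 6))))))))))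

/-- Output all points. -/
def mainLoop : Prog :=
  .seq (.instr (.const 17 0)) (.whileLT 17 16 pointProg)

/-- The registers that are not changed in the main loop. -/
structure Ctx {K : Type*} (n M B r N : ℕ) (σ : State K) : Prop where
  reg0 : σ.reg 0 = n
  reg5 : σ.reg 5 = 0
  reg6 : σ.reg 6 = 1
  reg11 : σ.reg 11 = M
  reg13 : σ.reg 13 = B
  reg14 : σ.reg 14 = r
  reg16 : σ.reg 16 = N

theorem Ctx.congr {K : Type*} {n M B r N : ℕ} {σ τ : State K} (h : Ctx n M B r N σ)
    (hτ : ∀ i < 17, τ.reg i = σ.reg i) : Ctx n M B r N τ :=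
  ⟨(hτ 0 (by omega)).trans h.reg0, (hτ 5 (by omega)).trans h.reg5, (hτ 6 (by omega)).trans h.reg6,
    (hτ 11 (by omega)).trans h.reg11, (hτ 13 (by omega)).trans h.reg13,
    (hτ 14 (by omega)).trans h.reg14, (hτ 16 (by omega)).trans h.reg16⟩

section main

variable {K : Type*} [Field K] {α : ℕ → K}

theorem runs_fpowProg {σ : State K} (h6 : σ.reg 6 = 1) :
    Runs α fpowProg σ (σ.reg 22 * 3 + 3) fun τ =>
      τ.freg 1 = σ.freg 0 ^ σ.reg 22 ∧ τ.freg 0 = σ.freg 0 ∧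
      (∀ i, i ≠ 24 → τ.reg i = σ.reg i) ∧ τ.fheap = σ.fheap ∧ τ.output = σ.output := by
  refine Runs.mono (Runs.instr_seq (Runs.instr_seq (Runs.while (σ.reg 22)
    (fun i ρ => ρ.freg 1 = σ.freg 0 ^ i ∧ ρ.freg 0 = σ.freg 0 ∧ ρ.reg 24 = i ∧ i ≤ σ.reg 22 ∧
      (∀ i, i ≠ 24 → ρ.reg i = σ.reg i) ∧ ρ.fheap = σ.fheap ∧ ρ.output = σ.output)
    (c := 1 + 1) ?_ ?_ ?_))) (by omega) fun _ h => h
  · simp only [Instr.step]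
    exact ⟨by simp, by simp, by simp, by omega, fun i hi => by simp [hi], trivial, trivial⟩
  · rintro i ρ ⟨h1, h2, h3, h4, h5, h7, h8⟩ hlt
    rw [h3, h5 22 (by omega)] at hlt
    refine ⟨hlt, Runs.instr_seq (Runs.instr ?_)⟩
    simp only [Instr.step]
    exact ⟨by simp [h1, h2, pow_succ], by simp [h2], by simp [h3, h5 6, h6], by omega,
      fun j hj => by simp [hj, h5 j hj], h7, h8⟩
  · rintro i ρ ⟨h1, h2, h3, h4, h5, h7, h8⟩ hlt
    rw [h3, h5 22 (by omega)] at hlt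
    have : i = σ.reg 22 := by omega
    exact ⟨this ▸ h1, h2, h5, h7, h8⟩

/-- Each weight arises from the previous one by a multiplication and a reduction modulo `q`.
Exponents thus stay at most `V`, and computing powers by repeated multiplication takes time linear
in `V`; the dominant cost is the division of a number up to `V * V`. -/
theorem runs_baseProg {n q k V : ℕ} {σ : State K} (h0 : σ.reg 0 = n) (h5 : σ.reg 5 = 0)
    (h6 : σ.reg 6 = 1) (h20 : σ.reg 20 = q) (h21 : σ.reg 21 = k) (hq : 0 < q) (hqV : q ≤ V)
    (hkV : k ≤ V) :
    Runs α baseProg σ (n * (3 * (V * V) + 6 * V + 14) + 3) fun τ =>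
      (∀ v < n, τ.fheap v = σ.freg 0 ^ weight q k v) ∧
      (∀ i < 22, τ.reg i = σ.reg i) ∧ τ.output = σ.output := by
  refine Runs.mono (Runs.instr_seq (Runs.instr_seq (Runs.while n
    (fun i ρ => (∀ v < i, ρ.fheap v = σ.freg 0 ^ weight q k v) ∧ ρ.freg 0 = σ.freg 0 ∧
      ρ.reg 22 = weight q k i ∧ ρ.reg 23 = i ∧ i ≤ n ∧
      (∀ i < 22, ρ.reg i = σ.reg i) ∧ ρ.output = σ.output)
    (c := (3 * (V * V) + 6 * V + 13)) ?_ ?_ ?_))) (by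
      rw [show 3 * (V * V) + 6 * V + 13 + 1 = 3 * (V * V) + 6 * V + 14 from rfl]; omega)
    fun _ h => h
  · simp only [Instr.step]
    exact ⟨by simp, trivial, by simp [weight], by simp, by omega,
      fun i hi => by simp [show i ≠ 23 by omega, show i ≠ 22 by omega], trivial⟩
  · rintro i ρ ⟨h1, h2, h3, h4, h7, h8, h9⟩ hlt
    rw [h4, h8 0 (by omega), h0] at hlt
    have hw : weight q k i ≤ V := (weight_le hq k i).trans hqV
    have hwk : weight q k i * k ≤ V * V := Nat.mul_le_mul hw hkV
    refine ⟨hlt, Runs.mono (T := (3 * V + 3) + (1 + ((3 * V + 3) + ((3 * (V * V) + 5) + 1)))) ?_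
      (by omega) fun _ h => h⟩
    refine Runs.seq (Runs.mono (runs_fpowProg ((h8 6 (by omega)).trans h6)) (by rw [h3]; omega)
      fun _ h => h) ?_
    rintro ρ₁ ⟨a1, a2, a3, a4, a5⟩
    refine Runs.instr_seq ?_
    have e1 : ∀ j, ((Instr.fstore 23 1).step α ρ₁).reg j = ρ₁.reg j := fun j => rfl
    have e2 : ((Instr.fstore 23 1).step α ρ₁).reg 21 = k := by
      rw [e1, a3 21 (by omega), h8 21 (by omega), h21]
    have e3 : ((Instr.fstore 23 1).step α ρ₁).reg 22 = weight q k i := by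
      rw [e1, a3 22 (by omega), h3]
    refine Runs.seq (Runs.mono (runs_mulProg (by decide) (by
      rw [e1, a3 6 (by omega), h8 6 (by omega), h6])) (by rw [e2]; omega) fun _ h => h) ?_
    rintro ρ₂ ⟨b1, b2⟩
    rw [e2, e3] at b1
    have b3 : ∀ j, j ≠ 24 → j ≠ 25 → ρ₂.reg j = ρ.reg j := fun j hj hj' => by
      rw [b2.reg j (by simp [hj, hj']), e1, a3 j hj]
    have b20 : ρ₂.reg 20 = q := by rw [b3 20 (by omega) (by omega), h8 20 (by omega), h20]
    refine Runs.seq (Runs.mono (runs_digitProg (by decide)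
      (by rw [b3 5 (by omega) (by omega), h8 5 (by omega), h5])
      (by rw [b3 6 (by omega) (by omega), h8 6 (by omega), h6]) (by rw [b20]; exact hq))
      (by rw [b1]; omega) fun _ h => h) ?_
    rintro ρ₃ ⟨c1, c2, c3⟩
    rw [b1, b20] at c1
    have c4 : ∀ j, j ≠ 22 → j ≠ 24 → j ≠ 25 → ρ₃.reg j = ρ.reg j := fun j hj hj' hj'' => by
      rw [c3.reg j (by simp [hj, hj'']), b3 j hj' hj'']
    have c5 : ρ₃.fheap = Function.update ρ.fheap i (σ.freg 0 ^ weight q k i) := by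
      rw [c3.fheap, b2.fheap]
      simp only [Instr.step]
      rw [a4, a3 23 (by omega), h4, a1, h2, h3]
    have c6 : ρ₃.freg 0 = σ.freg 0 := by
      rw [c3.freg, b2.freg]
      exact a2.trans h2
    have c7 : ρ₃.output = σ.output := by
      rw [c3.output, b2.output]
      exact a5.trans h9
    refine Runs.instr ?_
    simp only [Instr.step]
    refine ⟨fun v hv => ?_, c6, by simp [c1, weight], ?_, by omega, fun j hj => ?_, c7⟩
    · rw [c5]
      by_cases hvi : v = i
      · subst hvi; simp
      · rw [Function.update_of_ne hvi, h1 v (by omega)]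
    · simp [c4 23, c4 6, h4, h8 6, h6]
    · simp only [Function.update_of_ne (show j ≠ 23 by omega)]
      rw [c4 j (by omega) (by omega) (by omega), h8 j hj]
  · rintro i ρ ⟨h1, h2, h3, h4, h7, h8, h9⟩ hlt
    rw [h4, h8 0 (by omega), h0] at hlt
    have : i = n := by omega
    exact ⟨this ▸ h1, h8, h9⟩

theorem runs_overwriteProg {M r V : ℕ} {σ : State K} (h5 : σ.reg 5 = 0) (h6 : σ.reg 6 = 1)
    (h11 : σ.reg 11 = M) (h14 : σ.reg 14 = r) (hM : 0 < M) (h18 : σ.reg 18 ≤ V) :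
    Runs α overwriteProg σ (r * (6 * V + 14) + 2) fun τ =>
      τ.fheap = overwrite α M r (σ.reg 18) σ.fheap ∧
      (∀ i < 18, τ.reg i = σ.reg i) ∧ τ.output = σ.output := by
  -- The invariant follows the tail recursion of `overwrite`: applying the remaining `r - i` changes
  -- to the current heap yields the final heap.
  refine Runs.mono (Runs.instr_seq (Runs.while r
    (fun i ρ => overwrite α M (r - i) (ρ.reg 18) ρ.fheap = overwrite α M r (σ.reg 18) σ.fheap ∧
      ρ.reg 18 ≤ V ∧ ρ.reg 23 = i ∧ i ≤ r ∧ (∀ i < 18, ρ.reg i = σ.reg i) ∧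
      ρ.output = σ.output) (c := (6 * V + 13)) ?_ ?_ ?_)) (by
      rw [show 6 * V + 13 + 1 = 6 * V + 14 from rfl]; omega) fun _ h => h
  · simp only [Instr.step]
    exact ⟨by simp, by simpa using h18, by simp, by omega,
      fun i hi => by simp [show i ≠ 23 by omega], trivial⟩
  · rintro i ρ ⟨h1, h2, h3, h4, h7, h8⟩ hlt
    rw [h3, h7 14 (by omega), h14] at hlt
    refine ⟨hlt, Runs.mono (T := (3 * V + 5) + ((3 * V + 5) + (1 + (1 + 1)))) ?_
      (by omega) fun _ h => h⟩
    have f11 : ρ.reg 11 = M := (h7 11 (by omega)).trans h11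
    refine Runs.seq (Runs.mono (runs_digitProg (by decide) ((h7 5 (by omega)).trans h5)
      ((h7 6 (by omega)).trans h6) (by rw [f11]; exact hM)) (by omega) fun _ h => h) ?_
    rintro ρ₁ ⟨a1, a2, a3⟩
    have a4 : ∀ j, j ≠ 18 → j ≠ 24 → ρ₁.reg j = ρ.reg j := fun j hj hj' =>
      a3.reg j (by simp [hj, hj'])
    have a11 : ρ₁.reg 11 = M := by rw [a4 11 (by omega) (by omega), f11]
    rw [f11] at a1 a2
    refine Runs.seq (Runs.mono (runs_digitProg (by decide)
      (by rw [a4 5 (by omega) (by omega), h7 5 (by omega), h5])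
      (by rw [a4 6 (by omega) (by omega), h7 6 (by omega), h6]) (by rw [a11]; exact hM))
      (by rw [a2]; have := Nat.div_le_self (ρ.reg 18) M; omega) fun _ h => h) ?_
    rintro ρ₂ ⟨b1, b2, b3⟩
    rw [a11, a2] at b1 b2
    have b4 : ∀ j, j ≠ 18 → j ≠ 24 → j ≠ 25 → ρ₂.reg j = ρ.reg j := fun j hj hj' hj'' => by
      rw [b3.reg j (by simp [hj, hj'']), a4 j hj hj']
    have b24 : ρ₂.reg 24 = ρ.reg 18 % M := by rw [b3.reg 24 (by simp), a1]
    have bh : ρ₂.fheap = ρ.fheap := b3.fheap.trans a3.fheap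
    refine Runs.instr_seq (Runs.instr_seq (Runs.instr ?_))
    simp only [Instr.step]
    refine ⟨?_, ?_, ?_, by omega, fun j hj => ?_, (b3.output.trans a3.output).trans h8⟩
    · rw [← h1, show r - i = r - (i + 1) + 1 by omega, overwrite]
      simp [b1, b2, b24, bh]
    · simp only [Function.update_of_ne (show 18 ≠ 23 by omega)]
      rw [b2]
      exact (Nat.div_le_self _ _).trans ((Nat.div_le_self _ _).trans h2)
    · simp [b4 23, b4 6, h3, h7 6, h6]
    · simp only [Function.update_of_ne (show j ≠ 23 by omega)]
      rw [b4 j (by omega) (by omega) (by omega), h7 j hj]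
  · rintro i ρ ⟨h1, h2, h3, h4, h7, h8⟩ hlt
    rw [h3, h7 14 (by omega), h14] at hlt
    have : i = r := by omega
    rw [this, Nat.sub_self, overwrite] at h1
    exact ⟨h1, h7, h8⟩

theorem runs_outputProg {n : ℕ} {σ : State K} (h0 : σ.reg 0 = n) (h6 : σ.reg 6 = 1) :
    Runs α outputProg σ (n * 4 + 2) fun τ =>
      τ.output = σ.output ++ List.ofFn (fun v : Fin n => σ.fheap v) ∧
      (∀ i < 18, τ.reg i = σ.reg i) := by
  refine Runs.mono (Runs.instr_seq (Runs.while n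
    (fun i ρ => ρ.output = σ.output ++ (List.range i).map σ.fheap ∧ ρ.fheap = σ.fheap ∧
      ρ.reg 23 = i ∧ i ≤ n ∧ (∀ i < 18, ρ.reg i = σ.reg i)) (c := 1 + (1 + 1)) ?_ ?_ ?_))
    (by omega) fun _ h => h
  · simp only [Instr.step]
    exact ⟨by simp, trivial, by simp, by omega, fun i hi => by simp [show i ≠ 23 by omega]⟩
  · rintro i ρ ⟨h1, h2, h3, h4, h7⟩ hlt
    rw [h3, h7 0 (by omega), h0] at hlt
    refine ⟨hlt, Runs.instr_seq (Runs.instr_seq (Runs.instr ?_))⟩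
    simp only [Instr.step]
    refine ⟨?_, h2, ?_, by omega, fun j hj => ?_⟩
    · simp [h1, h2, h3, List.range_succ]
    · simp [h3, h7 6, h6]
    · simp [show j ≠ 23 by omega, h7 j hj]
  · rintro i ρ ⟨h1, h2, h3, h4, h7⟩ hlt
    rw [h3, h7 0 (by omega), h0] at hlt
    have : i = n := by omega
    subst this
    exact ⟨by rw [h1, ofFn_eq_map_range _ σ.fheap fun _ => rfl], h7⟩

/-- A single `V` bounds all parameters. The cubic term comes from `n ≤ V` weights, each with a
division costing `O(V²)`. -/
theorem runs_pointProg {n M B r N V : ℕ} {σ : State K} (hσ : Ctx n M B r N σ) (hM : 0 < M)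
    (hB : 0 < B) (hnV : n ≤ V) (hBV : B ≤ V) (hrV : r ≤ V) (hxV : σ.reg 17 ≤ V) :
    Runs α pointProg σ (3 * (V * V * V) + 12 * (V * V) + 41 * V + 30) fun τ =>
      τ.output = σ.output ++ List.ofFn (fun v : Fin n => point α B M r (σ.reg 17) v) ∧
      τ.reg 17 = σ.reg 17 + 1 ∧ ∀ i < 17, τ.reg i = σ.reg i := by
  obtain ⟨x, hx⟩ : ∃ x, σ.reg 17 = x := ⟨_, rfl⟩
  rw [hx] at hxV
  have hn1 : n * (3 * (V * V) + 6 * V + 14) + 3 ≤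
      3 * (V * V * V) + 6 * (V * V) + 14 * V + 3 := by
    calc n * (3 * (V * V) + 6 * V + 14) + 3 ≤ V * (3 * (V * V) + 6 * V + 14) + 3 := by gcongr
      _ = _ := by ring
  have hr1 : r * (6 * V + 14) + 2 ≤ 6 * (V * V) + 14 * V + 2 := by
    calc r * (6 * V + 14) + 2 ≤ V * (6 * V + 14) + 2 := by gcongr
      _ = _ := by ring
  refine Runs.mono (T := 1 + ((3 * V + 5) + (1 + ((3 * V + 5) + (1 + ((3 * V + 5) +
    ((3 * (V * V * V) + 6 * (V * V) + 14 * V + 3) + ((6 * (V * V) + 14 * V + 2) +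
    ((4 * V + 2) + 1))))))))) ?_ (by omega) fun _ h => h
  refine Runs.instr_seq ?_
  set σ₁ := (Instr.add 18 17 5).step α σ with hσ₁
  have s1 : ∀ i, i ≠ 18 → σ₁.reg i = σ.reg i := fun i hi => by simp [hσ₁, Instr.step, hi]
  have s18 : σ₁.reg 18 = x := by simp [hσ₁, Instr.step, hx, hσ.reg5]
  have so : σ₁.output = σ.output := rfl
  clear_value σ₁
  have c1 : Ctx n M B r N σ₁ := hσ.congr fun i hi => s1 i (by omega)
  refine Runs.seq (Runs.mono (runs_digitProg (by decide) c1.reg5 c1.reg6 (by rw [c1.reg13]; exact hB))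
    (by rw [s18]; omega) fun _ h => h) ?_
  rintro σ₂ ⟨t1, t2, t3⟩
  rw [s18, c1.reg13] at t1 t2
  have u2 : ∀ i < 17, σ₂.reg i = σ₁.reg i := fun i hi =>
    t3.reg i (by simp [show i ≠ 18 by omega, show i ≠ 19 by omega])
  have v2 : σ₂.reg 17 = x := by rw [t3.reg 17 (by simp), s1 17 (by omega), hx]
  refine Runs.instr_seq ?_
  set σ₃ := (Instr.felem 0 19).step α σ₂ with hσ₃
  have u3 : ∀ i, σ₃.reg i = σ₂.reg i := fun i => rfl
  have f3 : σ₃.freg 0 = α (x % B) := by simp [hσ₃, Instr.step, t1]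
  have o3 : σ₃.output = σ.output := t3.output.trans so
  clear_value σ₃
  have c3 : Ctx n M B r N σ₃ := c1.congr fun i hi => (u3 i).trans (u2 i hi)
  have d3 : σ₃.reg 18 = x / B := (u3 18).trans t2
  refine Runs.seq (Runs.mono (runs_digitProg (by decide) c3.reg5 c3.reg6 (by rw [c3.reg13]; exact hB))
    (by rw [d3]; have := Nat.div_le_self x B; omega) fun _ h => h) ?_
  rintro σ₄ ⟨t4, t5, t6⟩
  rw [d3, c3.reg13] at t4 t5
  refine Runs.instr_seq ?_
  set σ₅ := (Instr.add 20 20 6).step α σ₄ with hσ₅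
  have c4 : Ctx n M B r N σ₄ := c3.congr fun i hi =>
    t6.reg i (by simp [show i ≠ 18 by omega, show i ≠ 20 by omega])
  have u5 : ∀ i, i ≠ 20 → σ₅.reg i = σ₄.reg i := fun i hi => by simp [hσ₅, Instr.step, hi]
  have q5 : σ₅.reg 20 = x / B % B + 1 := by simp [hσ₅, Instr.step, t4, c4.reg6]
  have f5 : σ₅.freg 0 = α (x % B) := by
    rw [← f3, ← t6.freg]
    rfl
  have o5 : σ₅.output = σ.output := t6.output.trans o3
  have d5 : σ₅.reg 18 = x / B / B := (u5 18 (by omega)).trans t5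
  have v5 : σ₅.reg 17 = x := by
    rw [u5 17 (by omega), t6.reg 17 (by simp), u3, v2]
  clear_value σ₅
  have c5 : Ctx n M B r N σ₅ := c4.congr fun i hi => u5 i (by omega)
  have l5 : ∀ i < 17, σ₅.reg i = σ.reg i := fun i hi => by
    rw [u5 i (by omega), t6.reg i (by simp [show i ≠ 18 by omega, show i ≠ 20 by omega]), u3,
      u2 i hi, s1 i (by omega)]
  have hxBB : x / B / B ≤ x := (Nat.div_le_self _ _).trans (Nat.div_le_self _ _)
  refine Runs.seq (Runs.mono (runs_digitProg (by decide) c5.reg5 c5.reg6 (by rw [c5.reg13]; exact hB))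
    (by rw [d5]; omega) fun _ h => h) ?_
  rintro σ₆ ⟨t7, t8, t9⟩
  rw [d5, c5.reg13] at t7 t8
  have u6 : ∀ i, i ≠ 18 → i ≠ 21 → σ₆.reg i = σ₅.reg i := fun i hi hi' =>
    t9.reg i (by simp [hi, hi'])
  have c6 : Ctx n M B r N σ₆ := c5.congr fun i hi => u6 i (by omega) (by omega)
  have hB1 := Nat.mod_lt (x / B) hB
  have hB2 := Nat.mod_lt (x / B / B) hB
  refine Runs.seq (Runs.mono (runs_baseProg (V := V) c6.reg0 c6.reg5 c6.reg6
    ((u6 20 (by omega) (by omega)).trans q5) t7 (Nat.succ_pos _) (by omega) (by omega)) hn1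
    fun _ h => h) ?_
  rintro σ₇ ⟨b1, b2, b3⟩
  rw [t9.freg, f5] at b1
  have c7 : Ctx n M B r N σ₇ := c6.congr fun i hi => b2 i (by omega)
  have d7 : σ₇.reg 18 = x / B / B / B := (b2 18 (by omega)).trans t8
  have hxBBB : x / B / B / B ≤ x := (Nat.div_le_self _ _).trans hxBB
  refine Runs.seq (Runs.mono (runs_overwriteProg (V := V) c7.reg5 c7.reg6 c7.reg11 c7.reg14 hM
    (by rw [d7]; omega)) hr1 fun _ h => h) ?_
  rintro σ₈ ⟨e1, e2, e3⟩
  rw [d7] at e1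
  have c8 : Ctx n M B r N σ₈ := c7.congr fun i hi => e2 i (by omega)
  refine Runs.seq (Runs.mono (runs_outputProg c8.reg0 c8.reg6) (by omega) fun _ h => h) ?_
  rintro σ₉ ⟨g1, g2⟩
  have l9 : ∀ i < 18, σ₉.reg i = σ₅.reg i := fun i hi => by
    rw [g2 i hi, e2 i hi, b2 i (by omega), u6 i (by omega) (by omega)]
  have c9 : Ctx n M B r N σ₉ := c8.congr fun i hi => g2 i (by omega)
  refine Runs.instr ?_
  simp only [Instr.step]
  refine ⟨?_, ?_, fun i hi => ?_⟩
  · rw [g1, e3, b3, t9.output, o5, hx, e1]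
    congr 2
    funext v
    exact overwrite_congr α M r _ (fun v hv => b1 v hv) v v.2
  · simp [l9 17, v5, c9.reg6, hx]
  · simp only [Function.update_of_ne (show i ≠ 17 by omega)]
    rw [l9 i (by omega), l5 i hi]

theorem runs_mainLoop {n M B r N : ℕ} {σ : State K} (hσ : Ctx n M B r N σ) (hM : 0 < M)
    (hB : 0 < B) (hn : n ≤ N) (hBN : B ≤ N) (hr : r ≤ N) (ho : σ.output = []) :
    Runs α mainLoop σ (N * (3 * (N * N * N) + 12 * (N * N) + 41 * N + 31) + 2) fun τ =>
      τ.output = (List.range N).flatMap fun x => List.ofFn fun v : Fin n => point α B M r x v := by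
  refine Runs.mono (Runs.instr_seq (Runs.while N
    (fun i ρ => ρ.output =
      ((List.range i).flatMap fun x => List.ofFn fun v : Fin n => point α B M r x v) ∧
      ρ.reg 17 = i ∧ i ≤ N ∧ Ctx n M B r N ρ)
      (c := 3 * (N * N * N) + 12 * (N * N) + 41 * N + 30) ?_ ?_ ?_)) (by
      rw [show 3 * (N * N * N) + 12 * (N * N) + 41 * N + 30 + 1 =
        3 * (N * N * N) + 12 * (N * N) + 41 * N + 31 from rfl]; omega) fun _ h => h
  · refine ⟨by simp [Instr.step, ho], by simp [Instr.step], by omega, hσ.congr fun i hi => ?_⟩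
    simp [Instr.step, show i ≠ 17 by omega]
  · rintro i ρ ⟨h1, h2, h3, h4⟩ hlt
    rw [h2, h4.reg16] at hlt
    refine ⟨hlt, Runs.mono (runs_pointProg h4 hM hB hn hBN hr (by omega)) le_rfl ?_⟩
    rintro τ ⟨g1, g2, g3⟩
    refine ⟨?_, by omega, by omega, h4.congr g3⟩
    rw [g1, h1, h2, List.range_succ, List.flatMap_append]
    simp
  · rintro i ρ ⟨h1, h2, h3, h4⟩ hlt
    rw [h2, h4.reg16] at hlt
    have : i = N := by omega
    exact this ▸ h1

end main

/-! ### Setup of the parameters -/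

/-- `(9, 10) := (c, 2 ^ c)`, where `c` is the binary logarithm of register `8`, rounded up. -/
def clogProg : Prog :=
  .seq (.instr (.const 9 0)) (.seq (.instr (.const 10 1))
    (.whileLT 10 8 (.seq (.instr (.add 10 10 10)) (.instr (.add 9 9 6)))))

/-- Compute `w ^ 2` in register `7` and `min (clog 2 (w ^ 2 * s)) μ` in register `9`. -/
def minProg : Prog :=
  .seq (.instr (.add 8 1 5)) (.seq (mulProg 7 8 1 20) (.seq (mulProg 8 7 3 20)
    (.seq clogProg (.ifLT 4 9 (.instr (.add 9 4 5)) .skip))))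

/-- Compute the bases `M` and `B`. -/
def basesProg : Prog :=
  .seq (.instr (.add 11 0 2)) (.seq (.instr (.add 11 11 3)) (.seq (.instr (.const 20 11))
    (.seq (mulProg 12 7 20 21) (powProg 13 11 12 21 22 23))))

/-- Compute the number of changed coordinates and the number of points. -/
def countsProg : Prog :=
  .seq (.instr (.const 20 2)) (.seq (.instr (.add 20 7 20)) (.seq (mulProg 14 20 9 21)
    (.seq (.instr (.add 20 14 14)) (.seq (powProg 15 11 20 21 22 23)
      (.seq (mulProg 16 15 13 20) (.seq (mulProg 15 16 13 20) (mulProg 16 15 13 20)))))))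

/-- For a single variable: output the first `δ + 1` field elements. -/
def univariateProg : Prog :=
  .seq (.instr (.const 7 0)) (.seq (.instr (.add 8 2 6))
    (.whileLT 7 8 (.seq (.instr (.felem 0 7)) (.seq (.instr (.out 0)) (.instr (.add 7 7 6))))))

/-- The program that computes the hitting-sets. -/
def hittingSetProg : Prog :=
  .seq (.instr (.const 6 1)) (.ifLT 5 0 (.ifLT 5 1 (.ifLT 5 3 (.ifLT 6 0
    (.seq minProg (.seq basesProg (.seq countsProg mainLoop))) univariateProg) .skip) .skip) .skip)

section setup

variable {K : Type*} [Field K] {α : ℕ → K}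

theorem runs_clogProg {σ : State K} (h6 : σ.reg 6 = 1) :
    Runs α clogProg σ (Nat.clog 2 (σ.reg 8) * 3 + 3) fun τ =>
      τ.reg 9 = Nat.clog 2 (σ.reg 8) ∧ Frame [9, 10] σ τ := by
  refine Runs.mono (Runs.instr_seq (Runs.instr_seq (Runs.while (Nat.clog 2 (σ.reg 8))
    (fun i ρ => ρ.reg 10 = 2 ^ i ∧ ρ.reg 9 = i ∧ i ≤ Nat.clog 2 (σ.reg 8) ∧ Frame [9, 10] σ ρ)
    (c := 1 + 1) ?_ ?_ ?_))) (by omega) fun _ h => h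
  · simp only [Instr.step]
    refine ⟨by simp, by simp, by omega, ⟨fun r hr => ?_, rfl, rfl, rfl⟩⟩
    simp only [List.mem_cons, List.not_mem_nil, not_or, or_false] at hr
    simp [hr.1, hr.2]
  · rintro i ρ ⟨h1, h2, h3, h4⟩ hlt
    rw [h1, h4.reg 8 (by simp)] at hlt
    have hi : i < Nat.clog 2 (σ.reg 8) := by
      by_contra hge
      have := (Nat.clog_le_iff_le_pow (by norm_num)).1 (not_lt.1 hge)
      omega
    refine ⟨hi, Runs.instr_seq (Runs.instr ?_)⟩
    simp only [Instr.step]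
    refine ⟨by simp [h1, pow_succ]; omega, by simp [h2, h4.reg 6, h6], by omega,
      ⟨fun r hr => ?_, h4.freg, h4.fheap, h4.output⟩⟩
    have hr' := hr
    simp only [List.mem_cons, List.not_mem_nil, not_or, or_false] at hr
    simp [hr.1, hr.2, h4.reg r hr']
  · rintro i ρ ⟨h1, h2, h3, h4⟩ hlt
    rw [h1, h4.reg 8 (by simp), not_lt] at hlt
    have := (Nat.clog_le_iff_le_pow (by norm_num)).2 hlt
    exact ⟨by omega, h4⟩

theorem runs_minProg {w s μ V : ℕ} {σ : State K}
    (h1 : σ.reg 1 = w) (h3 : σ.reg 3 = s) (h4 : σ.reg 4 = μ) (h5 : σ.reg 5 = 0) (h6 : σ.reg 6 = 1)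
    (hw : w ≤ V) (hs : s ≤ V) (hW : w * w * s ≤ V) :
    Runs α minProg σ (9 * V + 12) fun τ =>
      τ.reg 7 = w * w ∧ τ.reg 9 = min (Nat.clog 2 (w ^ 2 * s)) μ ∧
      (∀ i < 7, τ.reg i = σ.reg i) ∧ τ.output = σ.output := by
  refine Runs.mono (T := 1 + ((3 * V + 3) + ((3 * V + 3) + ((3 * V + 3) + (1 + 1))))) ?_
    (by omega) fun _ h => h
  refine Runs.instr_seq ?_
  set σ₁ := (Instr.add 8 1 5).step α σ with hσ₁
  have a1 : ∀ i, i ≠ 8 → σ₁.reg i = σ.reg i := fun i hi => by simp [hσ₁, Instr.step, hi]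
  have a8 : σ₁.reg 8 = w := by simp [hσ₁, Instr.step, h1, h5]
  have ao : σ₁.output = σ.output := rfl
  clear_value σ₁
  refine Runs.seq (Runs.mono (runs_mulProg (by decide) (by rw [a1 6 (by omega), h6]))
    (by rw [a1 1 (by omega), h1]; omega) fun _ h => h) ?_
  rintro σ₂ ⟨b1, b2⟩
  rw [a8, a1 1 (by omega), h1] at b1
  have b3 : ∀ i < 7, σ₂.reg i = σ.reg i := fun i hi => by
    rw [b2.reg i (by simp [show i ≠ 7 by omega, show i ≠ 20 by omega]), a1 i (by omega)]
  refine Runs.seq (Runs.mono (runs_mulProg (by decide) (by rw [b3 6 (by omega), h6]))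
    (by rw [b3 3 (by omega), h3]; omega) fun _ h => h) ?_
  rintro σ₃ ⟨c1, c2⟩
  rw [b1, b3 3 (by omega), h3] at c1
  have c3 : ∀ i < 8, σ₃.reg i = σ₂.reg i := fun i hi =>
    c2.reg i (by simp [show i ≠ 8 by omega, show i ≠ 20 by omega])
  have hclog : Nat.clog 2 (w * w * s) ≤ V := by
    refine le_trans ?_ hW
    exact (Nat.clog_le_iff_le_pow (by norm_num)).2 Nat.lt_two_pow_self.le
  refine Runs.seq (Runs.mono (runs_clogProg (by rw [c3 6 (by omega), b3 6 (by omega), h6]))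
    (by rw [c1]; omega) fun _ h => h) ?_
  rintro σ₄ ⟨d1, d2⟩
  rw [c1] at d1
  have d3 : ∀ i < 8, σ₄.reg i = σ₂.reg i := fun i hi => by
    rw [d2.reg i (by simp [show i ≠ 9 by omega, show i ≠ 10 by omega]), c3 i hi]
  have d4 : σ₄.reg 4 = μ := by rw [d3 4 (by omega), b3 4 (by omega), h4]
  have d5 : σ₄.reg 5 = 0 := by rw [d3 5 (by omega), b3 5 (by omega), h5]
  have do' : σ₄.output = σ.output := by rw [d2.output, c2.output, b2.output, ao]
  refine Runs.ite (fun hlt => Runs.instr ?_) fun hlt => Runs.mono (Runs.skip ?_) (by omega)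
    fun _ h => h
  · rw [d4, d1] at hlt
    simp only [Instr.step]
    refine ⟨by simp [d3 7, b1], ?_, fun i hi => ?_, do'⟩
    · rw [sq, min_eq_right hlt.le]
      simp [d4, d5]
    · simp only [Function.update_of_ne (show i ≠ 9 by omega)]
      rw [d3 i (by omega), b3 i hi]
  · rw [d4, d1] at hlt
    refine ⟨by rw [d3 7 (by omega), b1], ?_, fun i hi => ?_, do'⟩
    · rw [sq, min_eq_left (not_lt.1 hlt), d1]
    · rw [d3 i (by omega), b3 i hi]

theorem runs_basesProg {n δ s W M V : ℕ} {σ : State K} (h0 : σ.reg 0 = n) (h2 : σ.reg 2 = δ)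
    (h3 : σ.reg 3 = s) (h5 : σ.reg 5 = 0) (h6 : σ.reg 6 = 1) (h7 : σ.reg 7 = W)
    (hM : n + δ + s = M) (hMV : M ≤ V) (hWV : W * 11 ≤ V) :
    Runs α basesProg σ (3 * (V * V) + 6 * V + 42) fun τ =>
      τ.reg 11 = M ∧ τ.reg 13 = M ^ (W * 11) ∧
      (∀ i < 11, τ.reg i = σ.reg i) ∧ τ.output = σ.output := by
  have hT : W * 11 * (M * 3 + 6) + 3 ≤ 3 * (V * V) + 6 * V + 3 := by
    calc W * 11 * (M * 3 + 6) + 3 ≤ V * (V * 3 + 6) + 3 := by gcongr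
      _ = _ := by ring
  refine Runs.mono (T := 1 + (1 + (1 + ((11 * 3 + 3) + (3 * (V * V) + 6 * V + 3))))) ?_
    (by omega) fun _ h => h
  refine Runs.instr_seq (Runs.instr_seq (Runs.instr_seq ?_))
  set σ₁ := (Instr.const 20 11).step α ((Instr.add 11 11 3).step α ((Instr.add 11 0 2).step α σ))
    with hσ₁
  have a1 : ∀ i < 11, σ₁.reg i = σ.reg i := fun i hi => by
    simp [hσ₁, Instr.step, show i ≠ 20 by omega, show i ≠ 11 by omega]
  have a11 : σ₁.reg 11 = M := by simp [hσ₁, Instr.step, h0, h2, h3, hM]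
  have a20 : σ₁.reg 20 = 11 := by simp [hσ₁, Instr.step]
  have ao : σ₁.output = σ.output := rfl
  clear_value σ₁
  refine Runs.seq (Runs.mono (runs_mulProg (by decide) (by rw [a1 6 (by omega), h6]))
    (by rw [a20]) fun _ h => h) ?_
  rintro σ₂ ⟨b1, b2⟩
  rw [a1 7 (by omega), a20, h7] at b1
  have b11 : σ₂.reg 11 = M := by rw [b2.reg 11 (by simp), a11]
  have b3 : ∀ i < 11, σ₂.reg i = σ.reg i := fun i hi => by
    rw [b2.reg i (by simp [show i ≠ 12 by omega, show i ≠ 21 by omega]), a1 i hi]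
  refine Runs.mono (runs_powProg (by decide) (by rw [b3 5 (by omega), h5])
    (by rw [b3 6 (by omega), h6])) (by rw [b1, b11]; exact hT) ?_
  rintro τ ⟨c1, c2⟩
  refine ⟨by rw [c2.reg 11 (by simp), b11], by rw [c1, b1, b11], fun i hi => ?_,
    c2.output.trans (b2.output.trans ao)⟩
  rw [c2.reg i (by simp; omega), b3 i hi]

theorem runs_countsProg {n W m M B r V : ℕ} {σ : State K} (h0 : σ.reg 0 = n)
    (h5 : σ.reg 5 = 0) (h6 : σ.reg 6 = 1) (h7 : σ.reg 7 = W) (h9 : σ.reg 9 = m)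
    (h11 : σ.reg 11 = M) (h13 : σ.reg 13 = B) (hr : (W + 2) * m = r) (hMV : M ≤ V) (hBV : B ≤ V)
    (hmV : m ≤ V) (hrV : r + r ≤ V) :
    Runs α countsProg σ (3 * (V * V) + 18 * V + 18) fun τ =>
      Ctx n M B r (B * (B * (B * (M * M) ^ r))) τ ∧ τ.output = σ.output := by
  have hT : (r + r) * (M * 3 + 6) + 3 ≤ 3 * (V * V) + 6 * V + 3 := by
    calc (r + r) * (M * 3 + 6) + 3 ≤ V * (V * 3 + 6) + 3 := by gcongr
      _ = _ := by ring
  refine Runs.mono (T := 1 + (1 + ((3 * V + 3) + (1 + ((3 * (V * V) + 6 * V + 3) + ((3 * V + 3) +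
    ((3 * V + 3) + (3 * V + 3)))))))) ?_ (by omega) fun _ h => h
  refine Runs.instr_seq (Runs.instr_seq ?_)
  set σ₁ := (Instr.add 20 7 20).step α ((Instr.const 20 2).step α σ) with hσ₁
  have a1 : ∀ i < 20, σ₁.reg i = σ.reg i := fun i hi => by
    simp [hσ₁, Instr.step, show i ≠ 20 by omega]
  have a20 : σ₁.reg 20 = W + 2 := by simp [hσ₁, Instr.step, h7]
  have ao : σ₁.output = σ.output := rfl
  clear_value σ₁
  refine Runs.seq (Runs.mono (runs_mulProg (by decide) (by rw [a1 6 (by omega), h6]))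
    (by rw [a1 9 (by omega), h9]; omega) fun _ h => h) ?_
  rintro σ₂ ⟨b1, b2⟩
  rw [a1 9 (by omega), a20, h9, hr] at b1
  have b3 : ∀ i < 14, σ₂.reg i = σ.reg i := fun i hi => by
    rw [b2.reg i (by simp; omega), a1 i (by omega)]
  refine Runs.instr_seq ?_
  set σ₃ := (Instr.add 20 14 14).step α σ₂ with hσ₃
  have c3 : ∀ i < 20, σ₃.reg i = σ₂.reg i := fun i hi => by
    simp [hσ₃, Instr.step, show i ≠ 20 by omega]
  have c20 : σ₃.reg 20 = r + r := by simp [hσ₃, Instr.step, b1]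
  have co : σ₃.output = σ.output := b2.output.trans ao
  clear_value σ₃
  have c11 : σ₃.reg 11 = M := by rw [c3 11 (by omega), b3 11 (by omega), h11]
  refine Runs.seq (Runs.mono (runs_powProg (by decide)
    (by rw [c3 5 (by omega), b3 5 (by omega), h5]) (by rw [c3 6 (by omega), b3 6 (by omega), h6]))
    (by rw [c20, c11]; exact hT) fun _ h => h) ?_
  rintro σ₄ ⟨d1, d2⟩
  rw [c20, c11] at d1
  have d3 : ∀ i < 15, σ₄.reg i = σ₂.reg i := fun i hi => by
    rw [d2.reg i (by simp; omega), c3 i (by omega)]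
  have d13 : σ₄.reg 13 = B := by rw [d3 13 (by omega), b3 13 (by omega), h13]
  have d6 : σ₄.reg 6 = 1 := by rw [d3 6 (by omega), b3 6 (by omega), h6]
  refine Runs.seq (Runs.mono (runs_mulProg (by decide) d6)
    (by rw [d13]; omega) fun _ h => h) ?_
  rintro σ₅ ⟨e1, e2⟩
  rw [d1, d13] at e1
  have e3 : ∀ i < 15, σ₅.reg i = σ₄.reg i := fun i hi => e2.reg i (by simp; omega)
  refine Runs.seq (Runs.mono (runs_mulProg (by decide) (by rw [e3 6 (by omega), d6]))
    (by rw [e3 13 (by omega), d13]; omega) fun _ h => h) ?_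
  rintro σ₆ ⟨f1, f2⟩
  rw [e1, e3 13 (by omega), d13] at f1
  have f3 : ∀ i < 15, σ₆.reg i = σ₄.reg i := fun i hi => by
    rw [f2.reg i (by simp; omega), e3 i hi]
  refine Runs.mono (runs_mulProg (by decide) (by rw [f3 6 (by omega), d6]))
    (by rw [f3 13 (by omega), d13]; omega) ?_
  rintro τ ⟨g1, g2⟩
  rw [f1, f3 13 (by omega), d13] at g1
  have g3 : ∀ i < 15, τ.reg i = σ₂.reg i := fun i hi => by
    rw [g2.reg i (by simp; omega), f3 i hi, d3 i hi]
  have g4 : ∀ i < 14, τ.reg i = σ.reg i := fun i hi => by rw [g3 i (by omega), b3 i hi]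
  refine ⟨⟨by rw [g4 0 (by omega), h0], by rw [g4 5 (by omega), h5], by rw [g4 6 (by omega), h6],
    by rw [g4 11 (by omega), h11], by rw [g4 13 (by omega), h13], by rw [g3 14 (by omega), b1],
    ?_⟩, ?_⟩
  · rw [g1, pow_add, mul_pow]
    ring
  · rw [g2.output, f2.output, e2.output, d2.output, co]

theorem runs_univariateProg {δ : ℕ} {σ : State K} (h2 : σ.reg 2 = δ) (h6 : σ.reg 6 = 1)
    (ho : σ.output = []) :
    Runs α univariateProg σ ((δ + 1) * 4 + 3) fun τ => τ.output = (List.range (δ + 1)).map α := by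
  refine Runs.mono (Runs.instr_seq (Runs.instr_seq (Runs.while (δ + 1)
    (fun i ρ => ρ.output = (List.range i).map α ∧ ρ.reg 7 = i ∧ i ≤ δ + 1 ∧ ρ.reg 8 = δ + 1 ∧
      ρ.reg 6 = 1) (c := 1 + (1 + 1)) ?_ ?_ ?_))) (by omega) fun _ h => h
  · simp [Instr.step, h2, h6, ho]
  · rintro i ρ ⟨h1, h3, h4, h5, h7⟩ hlt
    rw [h3, h5] at hlt
    refine ⟨hlt, Runs.instr_seq (Runs.instr_seq (Runs.instr ?_))⟩
    simp [Instr.step, h1, h3, h5, h7, List.range_succ]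
    omega
  · rintro i ρ ⟨h1, h3, h4, h5, h7⟩ hlt
    rw [h3, h5] at hlt
    have : i = δ + 1 := by omega
    exact this ▸ h1

end setup

/-! ### Bounds on the parameters -/

section bounds

variable {n w δ s M : ℕ}

/-- These are the two size conditions on `B` in `isHittingSet_points`. Powers of `M` dominate `w`
and `s ^ w`, and `M ≥ 4` absorbs the constants. -/
theorem shift_bounds (hw : 1 ≤ w) (hδ : 1 ≤ δ) (hs : 1 ≤ s) (hn : 1 ≤ n) (hM : n + δ + s = M)
    (hM4 : 4 ≤ M) :
    2 * (n * (s ^ w * s ^ w) * n + w * δ) ≤ M ^ (w * w * 11) ∧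
      n * (n * (w * δ * (2 * (n * (s ^ w * s ^ w) * n + w * δ)))) + 1 < M ^ (w * w * 11) := by
  have hwM : w ≤ M ^ w := (Nat.lt_pow_self (by omega)).le
  have hsM : s ^ w ≤ M ^ w := Nat.pow_le_pow_left (by omega) w
  have hnM : n ≤ M := by omega
  have hδM : δ ≤ M := by omega
  have h1 : n * (s ^ w * s ^ w) * n ≤ M ^ (2 * w + 2) := by
    calc n * (s ^ w * s ^ w) * n ≤ M * (M ^ w * M ^ w) * M := by gcongr
      _ = M ^ (2 * w + 2) := by ring
  have h2 : w * δ ≤ M ^ (w + 1) := by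
    calc w * δ ≤ M ^ w * M := Nat.mul_le_mul hwM hδM
      _ = M ^ (w + 1) := by ring
  have h3 : M ^ (w + 1) ≤ M ^ (2 * w + 2) := Nat.pow_le_pow_right (by omega) (by omega)
  have h4 : 2 * (n * (s ^ w * s ^ w) * n + w * δ) ≤ M ^ (2 * w + 3) := by
    calc 2 * (n * (s ^ w * s ^ w) * n + w * δ) ≤ 4 * M ^ (2 * w + 2) := by omega
      _ ≤ M * M ^ (2 * w + 2) := Nat.mul_le_mul_right _ hM4
      _ = M ^ (2 * w + 3) := by ring
  -- The exponent `11` comes from here: at `w = 1` the left side is `10`.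
  have hexp : 3 * w + 7 ≤ w * w * 11 := by nlinarith
  have h5 : M ^ (3 * w + 7) ≤ M ^ (w * w * 11) := Nat.pow_le_pow_right (by omega) hexp
  refine ⟨h4.trans (Nat.pow_le_pow_right (by omega) (by omega)), lt_of_lt_of_le ?_ h5⟩
  have h6 : n * (n * (w * δ * (2 * (n * (s ^ w * s ^ w) * n + w * δ)))) ≤ M ^ (3 * w + 6) := by
    calc n * (n * (w * δ * (2 * (n * (s ^ w * s ^ w) * n + w * δ))))
        ≤ M * (M * (M ^ (w + 1) * M ^ (2 * w + 3))) := by gcongr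
      _ = M ^ (3 * w + 6) := by ring
  have h7 : 1 ≤ M ^ (3 * w + 6) := Nat.one_le_pow _ _ (by omega)
  calc n * (n * (w * δ * (2 * (n * (s ^ w * s ^ w) * n + w * δ)))) + 1
      ≤ 2 * M ^ (3 * w + 6) := by omega
    _ < 4 * M ^ (3 * w + 6) := by omega
    _ ≤ M * M ^ (3 * w + 6) := Nat.mul_le_mul_right _ hM4
    _ = M ^ (3 * w + 7) := by ring

/-- The number of points is polynomial in `(n δ s) ^ (ℓ w ^ 2)`. -/
theorem points_le {μ : ℕ} (hw : 1 ≤ w) (hδ : 1 ≤ δ) (hs : 1 ≤ s) (hn : 2 ≤ n)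
    (hM : n + δ + s = M) {B r : ℕ} (hB : M ^ (w * w * 11) = B)
    (hr : (w * w + 2) * min (Nat.clog 2 (w ^ 2 * s)) μ = r) :
    B * (B * (B * (M * M) ^ r)) ≤ ((n * δ * s) ^ (ell w s μ * w ^ 2)) ^ 111 := by
  obtain ⟨m, hm⟩ : ∃ m, min (Nat.clog 2 (w ^ 2 * s)) μ = m := ⟨_, rfl⟩
  obtain ⟨D, hD⟩ : ∃ D, n * δ * s = D := ⟨_, rfl⟩
  have hδs : 1 ≤ δ * s := Nat.mul_pos hδ hs
  have hns : 1 ≤ n * s := Nat.mul_pos (by omega) hs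
  have hnδ : 1 ≤ n * δ := Nat.mul_pos (by omega) hδ
  have h1 : n ≤ D := by rw [← hD, mul_assoc]; exact Nat.le_mul_of_pos_right n hδs
  have h2 : s ≤ D := by rw [← hD]; exact Nat.le_mul_of_pos_left s hnδ
  have h3 : δ ≤ D := by
    rw [← hD, mul_right_comm]; exact Nat.le_mul_of_pos_left δ hns
  -- Here `n ≥ 2` is essential: it yields `D ≥ 2`, whence `M ≤ 3 * D ≤ D ^ 3`. For `n = δ = s = 1`
  -- one has `D = 1` and `M = 3`.
  have hMD : M ≤ D ^ 3 := by
    have h2D : 2 ≤ D := by omega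
    have : 2 * 2 * D ≤ D * D * D := by gcongr
    calc M ≤ 2 * 2 * D := by omega
      _ ≤ D * D * D := this
      _ = D ^ 3 := by ring
  have hD1 : 1 ≤ D := by omega
  rw [ell, hD, hm]
  rw [hm] at hr
  -- The left side is `99 w² + 6 (w² + 2) m`, which is at most `99 w² + 18 w² m` because `m ≤ w² m`;
  -- the constant `111` leaves room.
  have hexp : 3 * (w * w * 11 * 3 + 2 * r) ≤ (1 + 2 * m) * w ^ 2 * 111 := by
    rw [← hr]
    have hww : 1 ≤ w * w := Nat.mul_pos hw hw
    have : m ≤ w * w * m := Nat.le_mul_of_pos_left m hww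
    nlinarith
  calc B * (B * (B * (M * M) ^ r)) = M ^ (w * w * 11 * 3 + 2 * r) := by
        rw [← hB, pow_add, mul_comm 2 r, pow_mul, pow_mul, pow_mul, mul_pow]; ring
    _ ≤ (D ^ 3) ^ (w * w * 11 * 3 + 2 * r) := Nat.pow_le_pow_left hMD _
    _ = D ^ (3 * (w * w * 11 * 3 + 2 * r)) := by rw [pow_mul]
    _ ≤ D ^ ((1 + 2 * m) * w ^ 2 * 111) := Nat.pow_le_pow_right hD1 hexp
    _ = (D ^ ((1 + 2 * m) * w ^ 2)) ^ 111 := by rw [pow_mul]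

end bounds

/-! ### The hitting-set property of the program -/

section final

theorem HitsWithin.mono.{u₁, u₂} {P : Prog} {n w δ s μ T T' : ℕ}
    (h : HitsWithin.{u₁, u₂} P n w δ s μ T) (hT : T ≤ T') :
    HitsWithin.{u₁, u₂} P n w δ s μ T' := by
  intro F K _ _ _ α hα
  obtain ⟨t, τ, L, h1, h2, h3, h4, h5⟩ := h F K α (hα.mono (Set.Iio_subset_Iio hT))
  exact ⟨t, τ, L, h1, h2.trans hT, h3, h4.trans hT, h5⟩

/-- It suffices to bound the time, and to know that the output is correct. -/
theorem hitsWithin_of_runs.{u₁, u₂} {P : Prog} {n w δ s μ T : ℕ}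
    (h : ∀ (F : Type u₁) (K : Type u₂) [Field F] [Field K] [Algebra F K] (α : ℕ → K),
      Set.InjOn α (Set.Iio T) → Runs α P (initState K n w δ s μ) T fun τ =>
        ∃ L : List (Fin n → K), τ.output = L.flatMap List.ofFn ∧ L.length ≤ T ∧
          IsHittingSet {a | a ∈ L} (polyClass F n w δ s μ)) :
    HitsWithin.{u₁, u₂} P n w δ s μ T := by
  intro F K _ _ _ α hα
  obtain ⟨t, τ, h1, h2, L, h3, h4, h5⟩ := h F K α hα
  exact ⟨t, τ, L, h1, h2, h3, h4, h5⟩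

variable {K : Type*} [Field K] {α : ℕ → K}

/-- The state after the first instruction. -/
theorem initState_step (n w δ s μ : ℕ) :
    ∃ σ : State K, (Instr.const 6 1).step α (initState K n w δ s μ) = σ ∧ σ.reg 0 = n ∧
      σ.reg 1 = w ∧ σ.reg 2 = δ ∧ σ.reg 3 = s ∧ σ.reg 4 = μ ∧ σ.reg 5 = 0 ∧ σ.reg 6 = 1 ∧
      σ.output = [] :=
  ⟨_, rfl, by simp [Instr.step, initState]⟩

theorem runs_hittingSetProg_of_many {F : Type*} [Field F] [Algebra F K] {n w δ s μ X T : ℕ}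
    (hw : 1 ≤ w) (hδ : 1 ≤ δ) (hs : 1 ≤ s) (hn : 2 ≤ n)
    (hX : X = (n * δ * s) ^ (ell w s μ * w ^ 2)) (hT : T = 300 * X ^ 444 + 20 * X + 100)
    (hα : Set.InjOn α (Set.Iio T)) :
    Runs α hittingSetProg (initState K n w δ s μ) T fun τ =>
      ∃ L : List (Fin n → K), τ.output = L.flatMap List.ofFn ∧ L.length ≤ T ∧
        IsHittingSet {a | a ∈ L} (polyClass F n w δ s μ) := by
  obtain ⟨M, hM⟩ : ∃ M, n + δ + s = M := ⟨_, rfl⟩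
  obtain ⟨B, hB⟩ : ∃ B, M ^ (w * w * 11) = B := ⟨_, rfl⟩
  obtain ⟨m, hm⟩ : ∃ m, min (Nat.clog 2 (w ^ 2 * s)) μ = m := ⟨_, rfl⟩
  obtain ⟨r, hr⟩ : ∃ r, (w * w + 2) * m = r := ⟨_, rfl⟩
  obtain ⟨N, hN⟩ : ∃ N, B * (B * (B * (M * M) ^ r)) = N := ⟨_, rfl⟩
  have hM4 : 4 ≤ M := by omega
  have hww : 1 ≤ w * w := Nat.mul_pos hw hw
  have hwww : w ≤ w * w := Nat.le_mul_of_pos_left w hw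
  have hB1 : w * w * 11 < B := by rw [← hB]; exact Nat.lt_pow_self (by omega)
  have hMB : M ≤ B := by
    rw [← hB]
    calc M = M ^ 1 := (pow_one M).symm
      _ ≤ _ := Nat.pow_le_pow_right (by omega) (by omega)
  have hWs : w * w * s ≤ B := by
    have h1 : w * w < M ^ (w * w) := Nat.lt_pow_self (by omega)
    calc w * w * s ≤ M ^ (w * w) * M := Nat.mul_le_mul h1.le (by omega)
      _ = M ^ (w * w + 1) := by ring
      _ ≤ M ^ (w * w * 11) := Nat.pow_le_pow_right (by omega) (by omega)
      _ = B := hB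
  have hMM : 1 ≤ (M * M) ^ r := Nat.one_le_pow _ _ (Nat.mul_pos (by omega) (by omega))
  have hB0 : 1 ≤ B := by omega
  have hBBM : 1 ≤ B * (B * (M * M) ^ r) := Nat.mul_pos hB0 (Nat.mul_pos hB0 hMM)
  have hBN : B ≤ N := by rw [← hN]; exact Nat.le_mul_of_pos_right B hBBM
  have hrN : r + r ≤ N := by
    have h1 : 2 * r < M ^ (2 * r) := Nat.lt_pow_self (by omega)
    have h2 : (M * M) ^ r = M ^ (2 * r) := by rw [pow_mul, sq]
    have h3 : (M * M) ^ r ≤ N := by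
      rw [← hN, ← mul_assoc, ← mul_assoc]
      exact Nat.le_mul_of_pos_left _ (Nat.mul_pos (Nat.mul_pos hB0 hB0) hB0)
    omega
  have hmr : m ≤ r := by rw [← hr]; exact Nat.le_mul_of_pos_left m (by omega)
  have hNX : N ≤ X ^ 111 := by
    rw [← hN, hX]
    exact points_le hw hδ hs hn hM hB (by rw [hm, hr])
  -- The exponent `444 = 4 * 111` reflects `N` points at cost `O(N³)` each.
  have hN4 : N * N * N * N ≤ X ^ 444 := by
    calc N * N * N * N = N ^ 4 := by ring
      _ ≤ (X ^ 111) ^ 4 := Nat.pow_le_pow_left hNX 4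
      _ = X ^ 444 := by rw [← pow_mul]
  have hN1 : 1 ≤ N := by omega
  have hN2 : N ≤ N * N := Nat.le_mul_of_pos_left N hN1
  have hN3 : N * N ≤ N * N * N := Nat.le_mul_of_pos_right _ hN1
  have hN5 : N * N * N ≤ N * N * N * N := Nat.le_mul_of_pos_right _ hN1
  have hloop : N * (3 * (N * N * N) + 12 * (N * N) + 41 * N + 31) + 2 =
      3 * (N * N * N * N) + 12 * (N * N * N) + 41 * (N * N) + 31 * N + 2 := by ring
  have hit : IsHittingSet {a | a ∈ (List.range N).map fun x (v : Fin n) => point α B M r x v}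
      (polyClass F n w δ s μ) := by
    obtain ⟨hb1, hb2⟩ := shift_bounds hw hδ hs (by omega) hM hM4
    rw [hB] at hb1 hb2
    -- Isolation needs only `s ≤ 2 ^ c`; the factor `w ^ 2` in the logarithm is harmless slack.
    have hs2 : s ≤ 2 ^ Nat.clog 2 (w ^ 2 * s) :=
      le_trans (Nat.le_mul_of_pos_left s (pow_pos hw 2)) (Nat.le_pow_clog (by norm_num) _)
    have hwδ : 0 < w * δ := Nat.mul_pos hw hδ
    refine isHittingSet_points α (M := M) (B := B) (c := Nat.clog 2 (w ^ 2 * s)) (by omega)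
      (by omega) hMB hs2 (hα.mono (Set.Iio_subset_Iio (by omega))) rfl (by omega) hb1 hb2 ?_
    rw [hm, sq, hr, hN]
    intro x hx
    exact List.mem_map.2 ⟨x, List.mem_range.2 hx, rfl⟩
  refine Runs.mono (T := 1 + (((9 * N + 12) + ((3 * (N * N) + 6 * N + 42) +
    ((3 * (N * N) + 18 * N + 18) + (N * (3 * (N * N * N) + 12 * (N * N) + 41 * N + 31) + 2)))) +
    1 + 1 + 1 + 1)) ?_ (by rw [hloop]; omega) fun _ h => h
  refine Runs.instr_seq ?_
  obtain ⟨σ, hσ, i0, i1, i2, i3, i4, i5, i6, io⟩ := initState_step (K := K) (α := α) n w δ s μ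
  rw [hσ]
  refine Runs.ite (fun _ => ?_) (fun h => absurd (by omega) h)
  refine Runs.ite (fun _ => ?_) (fun h => absurd (by omega) h)
  refine Runs.ite (fun _ => ?_) (fun h => absurd (by omega) h)
  refine Runs.ite (fun _ => ?_) (fun h => absurd (by omega) h)
  refine Runs.seq (runs_minProg (V := N) i1 i3 i4 i5 i6 (by omega) (by omega) (by omega)) ?_
  rintro σ₁ ⟨a1, a2, a3, a4⟩
  rw [hm] at a2
  have a5 : σ₁.reg 5 = 0 := by rw [a3 5 (by omega), i5]
  have a6 : σ₁.reg 6 = 1 := by rw [a3 6 (by omega), i6]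
  have a0 : σ₁.reg 0 = n := by rw [a3 0 (by omega), i0]
  refine Runs.seq (runs_basesProg (V := N) a0 (by rw [a3 2 (by omega), i2])
    (by rw [a3 3 (by omega), i3]) a5 a6 a1 hM (by omega) (by omega)) ?_
  rintro σ₂ ⟨b1, b2, b3, b4⟩
  rw [hB] at b2
  refine Runs.seq (runs_countsProg (V := N) (by rw [b3 0 (by omega), a0])
    (by rw [b3 5 (by omega), a5]) (by rw [b3 6 (by omega), a6]) (by rw [b3 7 (by omega), a1])
    (by rw [b3 9 (by omega), a2]) b1 b2 hr (by omega) hBN (by omega) hrN) ?_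
  rintro σ₃ ⟨c1, c2⟩
  rw [hN] at c1
  refine Runs.mono (runs_mainLoop c1 (by omega) hB0 (by omega) hBN (by omega)
    (by rw [c2, b4, a4, io])) le_rfl fun τ hτ => ?_
  refine ⟨(List.range N).map fun x (v : Fin n) => point α B M r x v, ?_, ?_, hit⟩
  · rw [hτ, List.flatMap_map]
  · rw [List.length_map, List.length_range]
    omega

/-- One variable needs its own branch: with `n = δ = s = 1` the time bound is a constant, whereas `M
^ (11 w²)` grows with `w`. -/
theorem runs_hittingSetProg_univariate {F : Type*} [Field F] [Algebra F K] {w δ s μ T : ℕ}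
    (hw : 1 ≤ w) (hδ : 1 ≤ δ) (hs : 1 ≤ s) (hT : 4 * δ + 12 ≤ T)
    (hα : Set.InjOn α (Set.Iio T)) :
    Runs α hittingSetProg (initState K 1 w δ s μ) T fun τ =>
      ∃ L : List (Fin 1 → K), τ.output = L.flatMap List.ofFn ∧ L.length ≤ T ∧
        IsHittingSet {a | a ∈ L} (polyClass F 1 w δ s μ) := by
  refine Runs.mono (T := 1 + (((δ + 1) * 4 + 3) + 1 + 1 + 1 + 1)) ?_ (by omega) fun _ h => h
  refine Runs.instr_seq ?_
  obtain ⟨σ, hσ, i0, i1, i2, i3, i4, i5, i6, io⟩ := initState_step (K := K) (α := α) 1 w δ s μ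
  rw [hσ]
  refine Runs.ite (fun _ => ?_) (fun h => absurd (by omega) h)
  refine Runs.ite (fun _ => ?_) (fun h => absurd (by omega) h)
  refine Runs.ite (fun _ => ?_) (fun h => absurd (by omega) h)
  refine Runs.ite (fun h => absurd h (by omega)) (fun _ => ?_)
  refine Runs.mono (runs_univariateProg i2 i6 io) le_rfl fun τ hτ => ?_
  refine ⟨(List.range (δ + 1)).map fun j _ => α j, ?_, ?_, ?_⟩
  · rw [hτ, List.flatMap_map, List.map_eq_flatMap]
    simp
  · rw [List.length_map, List.length_range]
    omega
  · exact isHittingSet_univariate α hδ (hα.mono (Set.Iio_subset_Iio (by omega)))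
      fun j hj => List.mem_map.2 ⟨j, List.mem_range.2 hj, rfl⟩

/-- On these inputs the time bound may be constant while other parameters are arbitrary, so the
program leaves at once through its positivity tests. -/
theorem runs_hittingSetProg_degenerate {n w δ s μ T : ℕ} (h : n = 0 ∨ w = 0 ∨ s = 0)
    (hT : 10 ≤ T) :
    Runs α hittingSetProg (initState K n w δ s μ) T fun τ => τ.output = [] := by
  refine Runs.mono (T := 1 + (0 + 1 + 1 + 1)) ?_ (by omega) fun _ h => h
  refine Runs.instr_seq ?_
  obtain ⟨σ, hσ, i0, i1, i2, i3, i4, i5, i6, io⟩ := initState_step (K := K) (α := α) n w δ s μ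
  rw [hσ]
  have hskip : ∀ T, Runs α .skip σ T fun τ => τ.output = [] := fun T =>
    Runs.mono (Runs.skip io) (Nat.zero_le T) fun _ h => h
  exact Runs.ite (fun _ => Runs.ite (fun _ => Runs.ite (fun _ => by omega) fun _ => hskip _)
    fun _ => hskip _) fun _ => hskip _

theorem hitsWithin_hittingSetProg.{u₁, u₂} (n w δ s μ : ℕ) (hδ : 1 ≤ δ) :
    HitsWithin.{u₁, u₂} hittingSetProg n w δ s μ
      (300 * ((n * δ * s) ^ (ell w s μ * w ^ 2)) ^ 444 +
        20 * (n * δ * s) ^ (ell w s μ * w ^ 2) + 100) := by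
  refine hitsWithin_of_runs fun F K _ _ _ α hα => ?_
  by_cases hdeg : n = 0 ∨ w = 0 ∨ s = 0
  · refine Runs.mono (runs_hittingSetProg_degenerate hdeg (by omega)) le_rfl fun τ hτ => ?_
    rcases hdeg with rfl | rfl | rfl
    -- The one point of `K ^ 0` has no coordinates, so the empty output encodes the list consisting
    -- of this point.
    · exact ⟨[Fin.elim0], by simp [hτ], by simp, isHittingSet_of_isEmpty ⟨Fin.elim0, by simp⟩⟩
    · exact ⟨[], by simp [hτ], by simp, fun C hC h => absurd (poly_eq_zero_of_width_zero hC) h⟩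
    · exact ⟨[], by simp [hτ], by simp,
        fun C hC h => absurd (poly_eq_zero_of_sparsity_zero hC) h⟩
  · simp only [not_or] at hdeg
    obtain ⟨hn, hw, hs⟩ := hdeg
    rcases Nat.lt_or_ge n 2 with hn2 | hn2
    · obtain rfl : n = 1 := by omega
      refine runs_hittingSetProg_univariate (by omega) hδ (by omega) ?_ hα
      have h1 : δ ≤ (1 * δ * s) ^ (ell w s μ * w ^ 2) := by
        calc δ ≤ 1 * δ * s := by
              rw [one_mul]; exact Nat.le_mul_of_pos_right δ (Nat.pos_of_ne_zero hs)
          _ ≤ _ := Nat.le_self_pow (Nat.mul_pos (by rw [ell]; omega)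
              (pow_pos (Nat.pos_of_ne_zero hw) 2)).ne' _
      omega
    · exact runs_hittingSetProg_of_many (by omega) hδ (by omega) hn2 rfl rfl hα

/-- Enlarging the exponent is legitimate for base zero too: if `w = 0` both exponents vanish, and
otherwise the exponent on the left is positive. -/
theorem pow_ell_le (n w δ s μ : ℕ) :
    (n * δ * s) ^ (ell w s μ * w ^ 2) ≤ (n * δ * s) ^ ((1 + 2 * μ) * w ^ 2) := by
  rcases Nat.eq_zero_or_pos w with rfl | hw
  · simp
  rcases Nat.eq_zero_or_pos (n * δ * s) with h | h
  · have h0 : ell w s μ * w ^ 2 ≠ 0 := (Nat.mul_pos (by rw [ell]; omega) (pow_pos hw 2)).ne'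
    rw [h, zero_pow h0]
    exact Nat.zero_le _
  · refine Nat.pow_le_pow_right h (Nat.mul_le_mul_right _ ?_)
    have := min_le_right (Nat.clog 2 (w ^ 2 * s)) μ
    rw [ell]
    omega

end final

end InvROABP

/-! ### The main theorem -/

theorem theorem3 :
    ∃ P : InvROABP.Prog,
      (∃ p : Polynomial ℕ, ∀ n w δ s μ : ℕ, 1 ≤ δ →
        InvROABP.HitsWithin.{u, v} P n w δ s μ
          (p.eval ((n * δ * s) ^ (InvROABP.ell w s μ * w ^ 2)))) ∧
      (∀ w μ : ℕ, ∃ q : Polynomial ℕ, ∀ n δ s : ℕ, 1 ≤ δ →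
        InvROABP.HitsWithin.{u, v} P n w δ s μ (q.eval (n * δ * s))) := by
  have heval : ∀ X : ℕ, (300 * Polynomial.X ^ 444 + 20 * Polynomial.X + 100 : Polynomial ℕ).eval X =
      300 * X ^ 444 + 20 * X + 100 := fun X => by simp
  -- For fixed `w` and `μ`, the exponent `ℓ w²` is at most the constant `(1 + 2 μ) w²`, so `q` is
  -- `p` composed with that power of the variable.
  refine ⟨InvROABP.hittingSetProg, ⟨300 * Polynomial.X ^ 444 + 20 * Polynomial.X + 100,
    fun n w δ s μ hδ => ?_⟩, fun w μ => ⟨(300 * Polynomial.X ^ 444 + 20 * Polynomial.X + 100).comp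
      (Polynomial.X ^ ((1 + 2 * μ) * w ^ 2)), fun n δ s hδ => ?_⟩⟩
  · rw [heval]
    exact InvROABP.hitsWithin_hittingSetProg n w δ s μ hδ
  · rw [Polynomial.eval_comp, heval, Polynomial.eval_pow, Polynomial.eval_X]
    refine (InvROABP.hitsWithin_hittingSetProg n w δ s μ hδ).mono ?_
    have := InvROABP.pow_ell_le n w δ s μ
    gcongr
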